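/- Let $n,N\in\mathbb N$, $c_1,\dots,c_N>0$ and $\omega_1,\dots,\omega_N\in\mathbb R^n$, where the $\omega_\ell$ are not all equal, and put $$f(x)=\log\sum_{\ell=1}^N c_\ell e^{\langle\omega_\ell,x\rangle},\qquad \Omega=\{\omega_1,\dots,\omega_N\},\qquad L_\Omega=\max_{\ell}\|\omega_\ell\|^2,\qquad \beta=\frac{\sum_\ell c_\ell}{\min_\ell c_\ell}.$$ Let $m$ be the dimension of the affine hull of $\Omega$, and let $\varphi>0$ be the smallest distance from a point $\omega\in\Omega$ to the affine span of a facet of $\operatorname{Conv}\Omega$ not containing $\omega$. Let $p^\star$ be the point of minimum Euclidean norm of the closure of $\operatorname{dom}f^*=\{p : f^*(p)<\infty\}$, where $f^*(p)=\sup_x(\langle p,x\rangle-f(x))$, and let $g(x)=f(x)-\langle p^\star,x\rangle$. Then $f$ is convex and $L_\Omega$-smooth (i.e. differentiable with $L_\Omega$-Lipschitz gradient, $L_\Omega>0$) and $g$ is bounded below. Moreover, let $L>0$ be any constant such that $f$ is $L$-smooth (for instance $L=L_\Omega$), and let $(A_k)_{k\ge0}$ be real numbers such that, with $\delta^+A_k=A_{k+1}-A_k$,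 $$A_0=0,\qquad 0<\delta^+A_k\le 2\sqrt{A_{k+1}/L}\quad(k\ge0),\qquad \delta^+A_k=\Theta(k).$$ Let $(x^{(k)})$ be generated by the accelerated gradient method started at $x^{(0)}=y^{(0)}=0$, $$x^{(k+1)}=y^{(k)}-\frac{(\delta^+A_k)^2}{4A_{k+1}}\nabla f(y^{(k)}),\qquad y^{(k+1)}=x^{(k+1)}+\frac{A_k\,\delta^+A_{k+1}}{A_{k+2}\,\delta^+A_k}\bigl(x^{(k+1)}-x^{(k)}\bigr),$$ or in its three-sequence form with $x^{(0)}=z^{(0)}=0$, $$y^{(k)}-x^{(k)}=\tfrac{\delta^+A_k}{A_{k+1}}(z^{(k)}-x^{(k)}),\quad z^{(k+1)}-z^{(k)}=-\tfrac{\delta^+A_k}{4}\nabla f(y^{(k)}),\quad A_k(x^{(k+1)}-x^{(k)})=\delta^+A_k\,(z^{(k+1)}-x^{(k+1)}).$$ Then $A_k>m^2/(\beta\varphi^2)$ for all sufficiently large $k$, and for every $k$ with $A_k>m^2/(\beta\varphi^2)$, $$\frac{\|\nabla f(x^{(k)})-p^\star\|^2}{2L_\Omega}\le g(x^{(k)})-\inf_{x\in\mathbb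 R^n}g(x)\le\frac{2m^2}{\varphi^2A_k}\Bigl(1+\log^2\Bigl(\frac{\beta\varphi^2A_k}{m^2}\Bigr)\Bigr),$$ where the right-hand side is $O(k^{-2}\log^2k)$ as $k\to\infty$. -/

import Mathlib

open Filter Asymptotics Topology

/-- The Euclidean space `ℝⁿ`. -/
abbrev Vec (n : ℕ) : Type := EuclideanSpace ℝ (Fin n)

noncomputable section

/-! Convex functions, conjugates, minimum-norm points -/

/-- The class of `L`-smooth convex functions on `ℝⁿ` (`L > 0`): finite-valued differentiable
convex functions with `L`-Lipschitz gradient. -/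
structure IsSmoothConvex {n : ℕ} (L : ℝ) (f : Vec n → ℝ) : Prop where
  pos : 0 < L
  convex : ConvexOn ℝ Set.univ f
  differentiable : Differentiable ℝ f
  lipschitz : ∀ x y : Vec n, ‖gradient f x - gradient f y‖ ≤ L * ‖x - y‖

/-- The Legendre--Fenchel conjugate `f*(p) = sup_x (⟨p, x⟩ - f x)`, with extended real values. -/
def fenchelConjugate {n : ℕ} (f : Vec n → ℝ) (p : Vec n) : EReal :=
  ⨆ x : Vec n, ((inner ℝ p x - f x : ℝ) : EReal)

/-- The domain of the conjugate, `{p | f*(p) < ∞}`. -/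
def conjugateDomain {n : ℕ} (f : Vec n → ℝ) : Set (Vec n) :=
  {p | fenchelConjugate f p < ⊤}

/-- `p` is a point of minimum Euclidean norm of the set `S`. -/
def IsMinNormPoint {n : ℕ} (p : Vec n) (S : Set (Vec n)) : Prop :=
  p ∈ S ∧ ∀ q ∈ S, ‖p‖ ≤ ‖q‖

/-- The tilted function `x ↦ f x - ⟨p, x⟩`. -/
def tilt {n : ℕ} (f : Vec n → ℝ) (p : Vec n) (x : Vec n) : ℝ :=
  f x - inner ℝ p x

/-! The accelerated gradient method -/

/-- The forward difference `δ⁺A_k = A_{k+1} - A_k`. -/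
def stepDiff (A : ℕ → ℝ) (k : ℕ) : ℝ := A (k + 1) - A k

/-- The step-size condition: `A_0 = 0`, `0 < δ⁺A_k ≤ 2 √(A_{k+1} / L)` and `δ⁺A_k = Θ(k)`. -/
structure StepSizeCondition (L : ℝ) (A : ℕ → ℝ) : Prop where
  zero : A 0 = 0
  pos : ∀ k, 0 < stepDiff A k
  le : ∀ k, stepDiff A k ≤ 2 * Real.sqrt (A (k + 1) / L)
  theta : (fun k : ℕ => stepDiff A k) =Θ[atTop] (fun k : ℕ => (k : ℝ))

/-- The accelerated gradient method in its three-sequence form. The third update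
`x_{k+1} - x_k = (δ⁺A_k / A_k) (z_{k+1} - x_{k+1})` is multiplied by `A_k`, so that for `k = 0`,
where `A_0 = 0`, it reads `x_1 = z_1`. -/
structure IsAGMThree {n : ℕ} (f : Vec n → ℝ) (A : ℕ → ℝ) (x₀ : Vec n)
    (x y z : ℕ → Vec n) : Prop where
  x_zero : x 0 = x₀
  z_zero : z 0 = x₀
  y_step : ∀ k, y k - x k = (stepDiff A k / A (k + 1)) • (z k - x k)
  z_step : ∀ k, z (k + 1) - z k = -((stepDiff A k / 4) • gradient f (y k))
  x_step : ∀ k, A k • (x (k + 1) - x k) = stepDiff A k • (z (k + 1) - x (k + 1))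

/-- The accelerated gradient method in its reduced two-sequence form. -/
structure IsAGMTwo {n : ℕ} (f : Vec n → ℝ) (A : ℕ → ℝ) (x₀ : Vec n)
    (x y : ℕ → Vec n) : Prop where
  x_zero : x 0 = x₀
  y_zero : y 0 = x₀
  x_step : ∀ k, x (k + 1) = y k - ((stepDiff A k) ^ 2 / (4 * A (k + 1))) • gradient f (y k)
  y_step : ∀ k, y (k + 1) = x (k + 1) +
    (A k * stepDiff A (k + 1) / (A (k + 2) * stepDiff A k)) • (x (k + 1) - x k)

/-- `x` is the sequence of iterates `x^{(k)}` of the accelerated gradient method with parameters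
`A` and initial point `x₀`, in either of the two formulations. -/
def IsAGMIterates {n : ℕ} (f : Vec n → ℝ) (A : ℕ → ℝ) (x₀ : Vec n) (x : ℕ → Vec n) : Prop :=
  (∃ y : ℕ → Vec n, IsAGMTwo f A x₀ x y) ∨ (∃ y z : ℕ → Vec n, IsAGMThree f A x₀ x y z)

/-! Geometric programming -/

/-- The objective `f(x) = log ∑_ℓ c_ℓ exp ⟨ω_ℓ, x⟩`. -/
def gpObjective {n N : ℕ} (c : Fin N → ℝ) (ω : Fin N → Vec n) (x : Vec n) : ℝ :=
  Real.log (∑ l, c l * Real.exp (inner ℝ (ω l) x))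

/-- `L_Ω = max_ℓ ‖ω_ℓ‖²`. -/
def gpSmoothness {n N : ℕ} (ω : Fin N → Vec n) : ℝ := ⨆ l, ‖ω l‖ ^ 2

/-- `β = (∑_ℓ c_ℓ) / c_min`, with `c_min = min_ℓ c_ℓ`. -/
def gpBeta {N : ℕ} (c : Fin N → ℝ) : ℝ := (∑ l, c l) / ⨅ l, c l

/-- The Newton polytope `Conv Ω`, with `Ω = {ω_1, …, ω_N}`. -/
def newtonPolytope {n N : ℕ} (ω : Fin N → Vec n) : Set (Vec n) :=
  convexHull ℝ (Set.range ω)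

/-- The dimension of the affine hull of a set. -/
def affDim {n : ℕ} (S : Set (Vec n)) : ℕ := Module.finrank ℝ (vectorSpan ℝ S)

/-- `F` is a facet of `P`: a nonempty exposed face whose dimension is one less than that
of `P`. (The faces of a polytope are exactly its exposed faces.) -/
def IsFacet {n : ℕ} (P F : Set (Vec n)) : Prop :=
  IsExposed ℝ P F ∧ F.Nonempty ∧ affDim F + 1 = affDim P

/-- The facet gap `φ`: the smallest distance from any `ω ∈ Ω` to the affine span of any facet
of `Conv Ω` not containing `ω`. -/
def facetGap {n N : ℕ} (ω : Fin N → Vec n) : ℝ :=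
  sInf {d : ℝ | ∃ (l : Fin N) (F : Set (Vec n)), IsFacet (newtonPolytope ω) F ∧ ω l ∉ F ∧
    d = Metric.infDist (ω l) (affineSpan ℝ F : Set (Vec n))}

/-- The bound `(2 m² / (φ² a)) (1 + log² (β φ² a / m²))`. -/
def gpBound (m β φ a : ℝ) : ℝ :=
  2 * m ^ 2 / (φ ^ 2 * a) * (1 + Real.log (β * φ ^ 2 * a / m ^ 2) ^ 2)

end

/-! Two independent estimates are balanced. On the optimization side, let `p` be the minimum-norm
point. The closed conjugate domain is the Newton polytope, which contains every gradient, so the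
projection inequality gives `⟨∇f - p, p⟩ ≥ 0`. Hence the method, although driven by `∇f` and not by
`∇g`, admits a Lyapunov function whose comparison point `u - (A_k/4) p` drifts with the iterates.
This yields `A_k (g(x_k) - g(u)) ≤ 2‖u‖²` for every `u` (`IsAGMIterates.tilt_sub_le`).

Since `g` may have no minimizer, one needs short near-minimizers: for each `v` and `δ ≤ β` some `u`
with `‖u‖ ≤ (m/φ) log(β/δ)` and `g(u) ≤ g(v) + δ` (`exists_tilt_le`). Project `v` to the direction
space of the affine hull and pick a maximizing exponent `ω_{i₀}`; the projection then lies in the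
polar cone of the differences `ω_l - ω_{i₀}`. Decompose it into at most `m` extreme rays and cut
every coefficient at `T = log(β/δ)/φ` (`exists_truncation`). Extreme rays are facet normals, so an
exponent off the facet loses at least `φ` per unit length (`IsUnitRay.facetGap_le`). Cutting a ray
therefore only affects terms already damped by `e^{-φT} = δ/β`.

Taking `δ = m²/(φ² A_k)` makes both errors comparable, up to the squared logarithm. -/

/-! ### Extreme rays of polar cones and truncation along them. -/

section PolyhedralCone

variable {E ι : Type*} [NormedAddCommGroup E] [InnerProductSpace ℝ E]

/-- The span of those vectors of the family `a` that are orthogonal to `x`. -/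
def tightSpan (a : ι → E) (x : E) : Submodule ℝ E :=
  Submodule.span ℝ (a '' {l | inner ℝ (a l) x = 0})

/-- The cone of vectors having nonpositive inner product with every member of `a`. -/
def polarCone (a : ι → E) : Set E := {x | ∀ l, inner ℝ (a l) x ≤ 0}

/-- `x` is a unit vector spanning an extreme ray of the polar cone, inside the span of `a`. -/
structure IsUnitRay (a : ι → E) (x : E) : Prop where
  norm_eq : ‖x‖ = 1
  mem_span : x ∈ Submodule.span ℝ (Set.range a)
  mem_polar : x ∈ polarCone a
  finrank_add_one :
    Module.finrank ℝ (tightSpan a x) + 1 = Module.finrank ℝ (Submodule.span ℝ (Set.range a))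

theorem inner_eq_zero_of_mem_tightSpan {a : ι → E} {x v w : E}
    (h : ∀ l, inner ℝ (a l) x = 0 → inner ℝ (a l) v = 0) (hw : w ∈ tightSpan a x) :
    inner ℝ w v = 0 := by
  have hle : tightSpan a x ≤ (ℝ ∙ v)ᗮ := by
    refine Submodule.span_le.2 ?_
    rintro _ ⟨l, hl, rfl⟩
    exact Submodule.mem_orthogonal_singleton_iff_inner_left.2 (h l hl)
  exact Submodule.mem_orthogonal_singleton_iff_inner_left.1 (hle hw)

theorem tightSpan_le_span (a : ι → E) (x : E) :
    tightSpan a x ≤ Submodule.span ℝ (Set.range a) :=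
  Submodule.span_mono (Set.image_subset_range _ _)

theorem tightSpan_mono {a : ι → E} {x y : E}
    (h : ∀ l, inner ℝ (a l) x = 0 → inner ℝ (a l) y = 0) : tightSpan a x ≤ tightSpan a y :=
  Submodule.span_mono (Set.image_mono fun l hl => h l hl)

theorem exists_inner_ne_zero {a : ι → E} {v : E} (hv : v ∈ Submodule.span ℝ (Set.range a))
    (hv0 : v ≠ 0) : ∃ l, inner ℝ (a l) v ≠ 0 := by
  by_contra! h
  have hle : Submodule.span ℝ (Set.range a) ≤ (ℝ ∙ v)ᗮ := by
    refine Submodule.span_le.2 ?_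
    rintro _ ⟨l, rfl⟩
    exact Submodule.mem_orthogonal_singleton_iff_inner_left.2 (h l)
  exact hv0 (inner_self_eq_zero.1 (Submodule.mem_orthogonal_singleton_iff_inner_left.1 (hle hv)))

/-- Moving inside the polar cone in a direction preserving the tight constraints, until a new
constraint becomes tight. -/
theorem exists_move [Finite ι] {a : ι → E} {x v : E} (hx : x ∈ polarCone a)
    (hv : ∀ l, inner ℝ (a l) x = 0 → inner ℝ (a l) v = 0) (h : ∃ l, 0 < inner ℝ (a l) v) :
    ∃ s : ℝ, 0 ≤ s ∧ x + s • v ∈ polarCone a ∧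
      (∀ l, inner ℝ (a l) x = 0 → inner ℝ (a l) (x + s • v) = 0) ∧
      tightSpan a x < tightSpan a (x + s • v) := by
  -- Ratio test: `l₀` is the first constraint hit when moving along `v`.
  obtain ⟨l₀, hl₀, hmin⟩ := Set.exists_min_image {l | 0 < inner ℝ (a l) v}
    (fun l => -inner ℝ (a l) x / inner ℝ (a l) v) (Set.toFinite _) h
  simp only [Set.mem_ofPred_eq] at hl₀ hmin
  have hxl₀ : inner ℝ (a l₀) x < 0 :=
    lt_of_le_of_ne (hx l₀) fun h0 => hl₀.ne' (hv l₀ h0)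
  set s := -inner ℝ (a l₀) x / inner ℝ (a l₀) v with hs
  have hs0 : 0 ≤ s := div_nonneg (by linarith) hl₀.le
  have htight : ∀ l, inner ℝ (a l) x = 0 → inner ℝ (a l) (x + s • v) = 0 := by
    intro l hl
    rw [inner_add_right, inner_smul_right, hl, hv l hl]
    simp
  have hnew : inner ℝ (a l₀) (x + s • v) = 0 := by
    rw [inner_add_right, inner_smul_right, hs]
    field_simp
    ring
  refine ⟨s, hs0, ?_, htight, lt_of_le_of_ne (tightSpan_mono htight) ?_⟩
  · intro l
    rw [inner_add_right, inner_smul_right]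
    rcases lt_or_ge 0 (inner ℝ (a l) v) with hl | hl
    · have := (le_div_iff₀ hl).1 (hmin l hl)
      linarith
    · have := mul_nonpos_of_nonneg_of_nonpos hs0 hl
      linarith [hx l]
  · intro heq
    have hmem : a l₀ ∈ tightSpan a x := by
      rw [heq]
      exact Submodule.subset_span ⟨l₀, hnew, rfl⟩
    exact hxl₀.ne (inner_eq_zero_of_mem_tightSpan (fun l hl => hl) hmem)

variable [FiniteDimensional ℝ E]

theorem finrank_tightSpan_lt {a : ι → E} {x : E} (hx : x ∈ Submodule.span ℝ (Set.range a))
    (hx0 : x ≠ 0) :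
    Module.finrank ℝ (tightSpan a x) < Module.finrank ℝ (Submodule.span ℝ (Set.range a)) := by
  refine Submodule.finrank_lt_finrank_of_lt (lt_of_le_of_ne (tightSpan_le_span a x) ?_)
  intro heq
  rw [← heq] at hx
  exact hx0 (inner_self_eq_zero.1 (inner_eq_zero_of_mem_tightSpan (fun l hl => hl) hx))

/-- Induction on the codimension of the tight span. While it exceeds one, there is room to move
orthogonally to both the tight vectors and `x` until a further constraint becomes tight; at
codimension one, normalizing suffices. -/
theorem exists_unitRay [Finite ι] {a : ι → E} {x : E}
    (hx : x ∈ Submodule.span ℝ (Set.range a)) (hx0 : x ≠ 0) (hxN : x ∈ polarCone a) :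
    ∃ n, IsUnitRay a n ∧ ∀ l, inner ℝ (a l) x = 0 → inner ℝ (a l) n = 0 := by
  induction hd : Module.finrank ℝ (Submodule.span ℝ (Set.range a)) -
    Module.finrank ℝ (tightSpan a x) using Nat.strong_induction_on generalizing x with
  | _ d ih =>
  have hlt := finrank_tightSpan_lt hx hx0
  by_cases h1 : Module.finrank ℝ (tightSpan a x) + 1 =
      Module.finrank ℝ (Submodule.span ℝ (Set.range a))
  · have hpos : 0 < ‖x‖⁻¹ := inv_pos.2 (norm_pos_iff.2 hx0)
    have hiff : ∀ l, inner ℝ (a l) (‖x‖⁻¹ • x) = 0 ↔ inner ℝ (a l) x = 0 := by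
      intro l
      rw [inner_smul_right, mul_eq_zero, or_iff_right hpos.ne']
    refine ⟨‖x‖⁻¹ • x, ⟨norm_smul_inv_norm hx0, Submodule.smul_mem _ _ hx, fun l => ?_, ?_⟩,
      fun l hl => (hiff l).2 hl⟩
    · rw [inner_smul_right]
      exact mul_nonpos_of_nonneg_of_nonpos hpos.le (hxN l)
    · rwa [le_antisymm (tightSpan_mono fun l => (hiff l).1) (tightSpan_mono fun l => (hiff l).2)]
  · set K := tightSpan a x ⊔ (ℝ ∙ x) with hK
    have hKV : K ≤ Submodule.span ℝ (Set.range a) :=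
      sup_le (tightSpan_le_span a x) ((Submodule.span_singleton_le_iff_mem _ _).2 hx)
    have hKd : Module.finrank ℝ K ≤ Module.finrank ℝ (tightSpan a x) + 1 :=
      (Submodule.finrank_add_le_finrank_add_finrank _ _).trans
        (Nat.add_le_add_left (finrank_span_singleton hx0).le _)
    have horth := Submodule.finrank_add_inf_finrank_orthogonal hKV
    have hne : Kᗮ ⊓ Submodule.span ℝ (Set.range a) ≠ ⊥ := by
      intro hbot
      rw [hbot, finrank_bot] at horth
      omega
    obtain ⟨v, hvmem, hv0⟩ := Submodule.exists_mem_ne_zero_of_ne_bot hne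
    obtain ⟨hvK, hvV⟩ := Submodule.mem_inf.1 hvmem
    obtain ⟨w, hwK, hwV, hwpos⟩ : ∃ w ∈ Kᗮ, w ∈ Submodule.span ℝ (Set.range a) ∧
        ∃ l, 0 < inner ℝ (a l) w := by
      obtain ⟨l, hl⟩ := exists_inner_ne_zero hvV hv0
      rcases lt_or_gt_of_ne hl with hl | hl
      · exact ⟨-v, Submodule.neg_mem _ hvK, Submodule.neg_mem _ hvV, l, by
          rw [inner_neg_right]; linarith⟩
      · exact ⟨v, hvK, hvV, l, hl⟩
    have hwt : ∀ l, inner ℝ (a l) x = 0 → inner ℝ (a l) w = 0 := fun l hl =>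
      Submodule.inner_right_of_mem_orthogonal
        (show a l ∈ K from (le_sup_left : tightSpan a x ≤ K) (Submodule.subset_span ⟨l, hl, rfl⟩)) hwK
    have hxw : inner ℝ x w = 0 := Submodule.inner_right_of_mem_orthogonal
      (show x ∈ K from (le_sup_right : (ℝ ∙ x) ≤ K) (Submodule.mem_span_singleton_self x)) hwK
    obtain ⟨s, -, hsN, hst, hslt⟩ := exists_move hxN hwt hwpos
    -- The move is orthogonal to `x`, so it cannot reach the origin.
    have hy0 : x + s • w ≠ 0 := by
      intro h0
      have h2 : inner ℝ x (x + s • w) = 0 := by rw [h0, inner_zero_right]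
      rw [inner_add_right, inner_smul_right, hxw, mul_zero, add_zero] at h2
      exact hx0 (inner_self_eq_zero.1 h2)
    have hyV : x + s • w ∈ Submodule.span ℝ (Set.range a) :=
      Submodule.add_mem _ hx (Submodule.smul_mem _ _ hwV)
    have hlt' := Submodule.finrank_lt_finrank_of_lt hslt
    obtain ⟨n, hn, hnt⟩ := ih _ (by omega) hyV hy0 hsN rfl
    exact ⟨n, hn, fun l hl => hnt l (hst l hl)⟩

/-- Every vector of the polar cone can be replaced by a short one whose negligible constraints
stay below `-φ T`, the difference remaining in the polar cone. -/
theorem exists_truncation [Finite ι] {a : ι → E} {φ T : ℝ} (hT : 0 ≤ T)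
    (hgap : ∀ n, IsUnitRay a n → ∀ l, inner ℝ (a l) n = 0 ∨ inner ℝ (a l) n ≤ -φ)
    {x : E} (hx : x ∈ Submodule.span ℝ (Set.range a)) (hxN : x ∈ polarCone a) :
    ∃ u, ‖u‖ ≤ (Module.finrank ℝ (Submodule.span ℝ (Set.range a)) -
        Module.finrank ℝ (tightSpan a x) : ℝ) * T ∧ u ∈ polarCone a ∧ x - u ∈ polarCone a ∧
      ∀ l, inner ℝ (a l) (x - u) = 0 ∨ inner ℝ (a l) u ≤ -(φ * T) := by
  induction hd : Module.finrank ℝ (Submodule.span ℝ (Set.range a)) -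
    Module.finrank ℝ (tightSpan a x) using Nat.strong_induction_on generalizing x with
  | _ d ih =>
  by_cases hx0 : x = 0
  · subst hx0
    refine ⟨0, ?_, by simpa using hxN, by simpa using hxN, fun l => Or.inl (by simp)⟩
    rw [norm_zero]
    refine mul_nonneg (sub_nonneg.2 ?_) hT
    exact_mod_cast Submodule.finrank_mono (tightSpan_le_span a (0 : E))
  have hlt := finrank_tightSpan_lt hx hx0
  obtain ⟨n, hn, hnt⟩ := exists_unitRay hx hx0 hxN
  have hn0 : n ≠ 0 := norm_ne_zero_iff.1 (by rw [hn.norm_eq]; exact one_ne_zero)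
  obtain ⟨l₀, hl₀⟩ := exists_inner_ne_zero hn.mem_span hn0
  -- Peel off the ray `n`: subtract it until another constraint becomes tight. The rank of the tight
  -- span rises each time, which pays for one more summand of length at most `T`.
  obtain ⟨s, hs, hsN, -, hslt⟩ := exists_move (v := -n) hxN
    (fun l hl => by rw [inner_neg_right, hnt l hl, neg_zero])
    ⟨l₀, by rw [inner_neg_right]; linarith [lt_of_le_of_ne (hn.mem_polar l₀) hl₀]⟩
  have hlt' := Submodule.finrank_lt_finrank_of_lt hslt
  obtain ⟨u, hu, huN, hxuN, hul⟩ := ih _ (by omega)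
    (Submodule.add_mem _ hx (Submodule.smul_mem _ _ (Submodule.neg_mem _ hn.mem_span))) hsN rfl
  have hmin0 : 0 ≤ min s T := le_min hs hT
  -- The ray enters the short vector with its coefficient `s` cut at `T`.
  have hsplit : x - (u + min s T • n) = (x + s • -n - u) + (s - min s T) • n := by
    module
  refine ⟨u + min s T • n, ?_, ?_, ?_, ?_⟩
  · have h1 : ‖min s T • n‖ ≤ T := by
      rw [norm_smul, hn.norm_eq, mul_one, Real.norm_eq_abs, abs_of_nonneg hmin0]
      exact min_le_right _ _
    have h2 : (Module.finrank ℝ (tightSpan a x) : ℝ) + 1 ≤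
        Module.finrank ℝ (tightSpan a (x + s • -n)) := by exact_mod_cast hlt'
    refine (norm_add_le _ _).trans ((add_le_add hu h1).trans ?_)
    nlinarith
  · intro l
    rw [inner_add_right, inner_smul_right]
    have := mul_nonpos_of_nonneg_of_nonpos hmin0 (hn.mem_polar l)
    linarith [huN l]
  · intro l
    rw [hsplit, inner_add_right, inner_smul_right]
    have := mul_nonpos_of_nonneg_of_nonpos (sub_nonneg.2 (min_le_left s T)) (hn.mem_polar l)
    linarith [hxuN l]
  · intro l
    rw [hsplit, inner_add_right, inner_add_right, inner_smul_right, inner_smul_right]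
    have hnl := hn.mem_polar l
    rcases hul l with h | h
    · rcases le_total s T with hsT | hsT
      · left
        rw [min_eq_left hsT, h]
        ring
      -- Here the ray really is cut: either `a l` does not see `n`, or the retained piece `T • n`
      -- alone contributes at most `-φ T`.
      · rw [min_eq_right hsT]
        rcases hgap n hn l with h0 | h0
        · left
          rw [h, h0]
          ring
        · right
          have := huN l
          nlinarith
    · right
      have := mul_nonpos_of_nonneg_of_nonpos hmin0 hnl
      linarith

end PolyhedralCone

/-! ### Extreme rays as facet normals, and the facet gap. -/

section Facets

/-- A point of a convex hull at which a linear functional attains its maximal value lies in the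
convex hull of the generators attaining that value. -/
theorem mem_convexHull_of_maximal {E ι : Type*} [AddCommGroup E] [Module ℝ E] {v : ι → E}
    (ℓ : E →ₗ[ℝ] ℝ) {M : ℝ} (hM : ∀ i, ℓ (v i) ≤ M) {p : E}
    (hp : p ∈ convexHull ℝ (Set.range v)) (hpM : M ≤ ℓ p) :
    p ∈ convexHull ℝ (v '' {i | ℓ (v i) = M}) := by
  set C := convexHull ℝ (v '' {i | ℓ (v i) = M}) with hC
  have hCM : ∀ q ∈ C, ℓ q = M := by
    have hsub : C ⊆ {q | ℓ q = M} := by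
      refine convexHull_min ?_ (convex_hyperplane ℓ.isLinear M)
      rintro _ ⟨i, hi, rfl⟩
      exact hi
    exact fun q hq => hsub hq
  -- This set contains all generators. A proper convex combination stays at level `M` only if both
  -- ends lie in `C`.
  have hconv : Convex ℝ {q | ℓ q < M ∨ q ∈ C} := by
    rw [convex_iff_forall_pos]
    intro q hq r hr s t hs ht hst
    have hval : ℓ (s • q + t • r) = s * ℓ q + t * ℓ r := by simp
    have hle : ∀ q ∈ {q | ℓ q < M ∨ q ∈ C}, ℓ q ≤ M := by
      rintro q (h | h)
      exacts [h.le, (hCM q h).le]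
    have hM1 : M = s * M + t * M := by rw [← add_mul, hst, one_mul]
    rcases hq with hq' | hq' <;> rcases hr with hr' | hr'
    · left; nlinarith
    · left; nlinarith [hle r (Or.inr hr')]
    · left; nlinarith [hle q (Or.inr hq')]
    · right; exact convex_convexHull ℝ _ hq' hr' hs.le ht.le hst
  have hsub : convexHull ℝ (Set.range v) ⊆ {q | ℓ q < M ∨ q ∈ C} := by
    refine convexHull_min ?_ hconv
    rintro _ ⟨i, rfl⟩
    rcases (hM i).lt_or_eq with h | h
    · exact Or.inl h
    · exact Or.inr (subset_convexHull ℝ _ ⟨i, h, rfl⟩)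
  exact (hsub hp).resolve_left (not_lt.2 hpM)

variable {n N : ℕ} {ω : Fin N → Vec n}

/-- The face of the Newton polytope on which `⟨v, ·⟩` is maximal. -/
def polytopeFace (ω : Fin N → Vec n) (v : Vec n) : Set (Vec n) :=
  {p ∈ newtonPolytope ω | ∀ q ∈ newtonPolytope ω, innerSL ℝ v q ≤ innerSL ℝ v p}

theorem mem_newtonPolytope (ω : Fin N → Vec n) (l : Fin N) : ω l ∈ newtonPolytope ω :=
  subset_convexHull ℝ _ (Set.mem_range_self l)

theorem inner_le_of_mem_newtonPolytope {v p : Vec n} {M : ℝ} (hM : ∀ l, inner ℝ (ω l) v ≤ M)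
    (hp : p ∈ newtonPolytope ω) : inner ℝ p v ≤ M := by
  have hsub : newtonPolytope ω ⊆ {q | innerSL ℝ v q ≤ M} := by
    refine convexHull_min ?_ (convex_halfSpace_le (innerSL ℝ v).toLinearMap.isLinear M)
    rintro _ ⟨l, rfl⟩
    simpa [real_inner_comm] using hM l
  simpa [real_inner_comm] using hsub hp

theorem affDim_newtonPolytope (ω : Fin N → Vec n) :
    affDim (newtonPolytope ω) = affDim (Set.range ω) := by
  unfold affDim newtonPolytope
  rw [← direction_affineSpan, affineSpan_convexHull, direction_affineSpan]

theorem vectorSpan_range_eq (ω : Fin N → Vec n) (i₀ : Fin N) :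
    vectorSpan ℝ (Set.range ω) = Submodule.span ℝ (Set.range fun l => ω l - ω i₀) :=
  vectorSpan_range_eq_span_range_vsub_right ℝ ω i₀

theorem mem_polytopeFace_iff {i₀ l : Fin N} {v : Vec n}
    (hv : v ∈ polarCone fun l => ω l - ω i₀) :
    ω l ∈ polytopeFace ω v ↔ inner ℝ (ω l - ω i₀) v = 0 := by
  have hle : ∀ l, inner ℝ (ω l) v ≤ inner ℝ (ω i₀) v := fun l => by
    have := hv l
    rw [inner_sub_left] at this
    linarith
  constructor
  · rintro ⟨-, h⟩
    have := h _ (mem_newtonPolytope ω i₀)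
    simp only [innerSL_apply_apply, real_inner_comm _ v] at this
    rw [inner_sub_left]
    linarith [hle l]
  · intro h
    rw [inner_sub_left] at h
    refine ⟨mem_newtonPolytope ω l, fun q hq => ?_⟩
    simp only [innerSL_apply_apply, real_inner_comm _ v]
    linarith [inner_le_of_mem_newtonPolytope hle hq]

theorem vectorSpan_polytopeFace {i₀ : Fin N} {v : Vec n}
    (hv : v ∈ polarCone fun l => ω l - ω i₀) :
    vectorSpan ℝ (polytopeFace ω v) = tightSpan (fun l => ω l - ω i₀) v := by
  have h0 : ω i₀ ∈ polytopeFace ω v := (mem_polytopeFace_iff hv).2 (by simp)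
  apply le_antisymm
  · have hsub : polytopeFace ω v ⊆
        (AffineSubspace.mk' (ω i₀) (tightSpan (fun l => ω l - ω i₀) v) : Set (Vec n)) := by
      rintro p ⟨hp, hmax⟩
      have hle : ∀ l, (innerSL ℝ v).toLinearMap (ω l) ≤ innerSL ℝ v (ω i₀) := fun l => by
        have := hv l
        rw [inner_sub_left] at this
        simp only [ContinuousLinearMap.coe_coe, innerSL_apply_apply, real_inner_comm _ v]
        linarith
      have hmem := mem_convexHull_of_maximal _ hle hp (hmax _ (mem_newtonPolytope ω i₀))
      refine convexHull_min ?_ (AffineSubspace.convex _) hmem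
      rintro _ ⟨l, hl, rfl⟩
      refine AffineSubspace.mem_mk'.2 (Submodule.subset_span ⟨l, ?_, rfl⟩)
      simp only [Set.mem_ofPred_eq, ContinuousLinearMap.coe_coe, innerSL_apply_apply] at hl
      change inner ℝ (ω l - ω i₀) v = 0
      rw [real_inner_comm, inner_sub_right, hl, sub_self]
    rw [← direction_affineSpan]
    refine (AffineSubspace.direction_le (affineSpan_le.2 hsub)).trans_eq ?_
    rw [AffineSubspace.direction_mk']
  · refine Submodule.span_le.2 ?_
    rintro _ ⟨l, hl, rfl⟩
    exact vsub_mem_vectorSpan ℝ ((mem_polytopeFace_iff hv).2 hl) h0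

theorem IsUnitRay.isFacet {i₀ : Fin N} {v : Vec n} (hv : IsUnitRay (fun l => ω l - ω i₀) v) :
    IsFacet (newtonPolytope ω) (polytopeFace ω v) := by
  refine ⟨fun _ => ⟨innerSL ℝ v, rfl⟩,
    ⟨ω i₀, (mem_polytopeFace_iff hv.mem_polar).2 (by simp)⟩, ?_⟩
  rw [affDim_newtonPolytope]
  unfold affDim
  rw [vectorSpan_polytopeFace hv.mem_polar, vectorSpan_range_eq ω i₀]
  exact hv.finrank_add_one

/-- Within the affine hull, `v` is a unit normal to its facet's span. The orthogonal projection of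
`ω l` along `v` lands in that span, at distance `|⟨ω l - ω i₀, v⟩|`. -/
theorem IsUnitRay.facetGap_le {i₀ : Fin N} {v : Vec n}
    (hv : IsUnitRay (fun l => ω l - ω i₀) v) {l : Fin N}
    (hl : inner ℝ (ω l - ω i₀) v ≠ 0) : facetGap ω ≤ -inner ℝ (ω l - ω i₀) v := by
  have hgap : facetGap ω ≤
      Metric.infDist (ω l) (affineSpan ℝ (polytopeFace ω v) : Set (Vec n)) := by
    refine csInf_le ⟨0, ?_⟩
      ⟨l, _, hv.isFacet, fun h => hl ((mem_polytopeFace_iff hv.mem_polar).1 h), rfl⟩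
    rintro _ ⟨_, _, _, _, rfl⟩
    exact Metric.infDist_nonneg
  set a : Fin N → Vec n := fun l => ω l - ω i₀ with ha
  set w : Vec n := a l - inner ℝ (a l) v • v with hw
  have hv0 : v ≠ 0 := norm_ne_zero_iff.1 (by rw [hv.norm_eq]; exact one_ne_zero)
  have hspan : (ℝ ∙ v) ≤ Submodule.span ℝ (Set.range a) :=
    (Submodule.span_singleton_le_iff_mem _ _).2 hv.mem_span
  -- Inclusion plus equality of dimensions: both sides have codimension one in the span of `a`.
  have heq : tightSpan a v = (ℝ ∙ v)ᗮ ⊓ Submodule.span ℝ (Set.range a) := by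
    refine Submodule.eq_of_le_of_finrank_eq (le_inf ?_ (tightSpan_le_span a v)) ?_
    · exact fun w hw => Submodule.mem_orthogonal_singleton_iff_inner_left.2
        (inner_eq_zero_of_mem_tightSpan (fun l hl => hl) hw)
    · have h1 := Submodule.finrank_add_inf_finrank_orthogonal hspan
      rw [finrank_span_singleton hv0] at h1
      have h2 := hv.finrank_add_one
      omega
  have hwt : w ∈ tightSpan a v := by
    rw [heq]
    refine ⟨Submodule.mem_orthogonal_singleton_iff_inner_left.2 ?_, Submodule.sub_mem _
      (Submodule.subset_span ⟨l, rfl⟩) (Submodule.smul_mem _ _ hv.mem_span)⟩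
    rw [hw, inner_sub_left, real_inner_smul_left, real_inner_self_eq_norm_sq, hv.norm_eq]
    ring
  have hmem : w + ω i₀ ∈ affineSpan ℝ (polytopeFace ω v) := by
    refine AffineSubspace.vadd_mem_of_mem_direction (s := affineSpan ℝ (polytopeFace ω v)) ?_
      (mem_affineSpan ℝ ((mem_polytopeFace_iff hv.mem_polar).2 (by simp)))
    rw [direction_affineSpan, vectorSpan_polytopeFace hv.mem_polar]
    exact hwt
  refine hgap.trans ((Metric.infDist_le_dist_of_mem hmem).trans_eq ?_)
  have hdiff : ω l - (w + ω i₀) = inner ℝ (a l) v • v := by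
    rw [hw, ha]
    module
  rw [dist_eq_norm, hdiff, norm_smul, hv.norm_eq, mul_one, Real.norm_eq_abs,
    abs_of_nonpos (hv.mem_polar l)]

theorem exists_mem_polarCone [Nonempty (Fin N)] (ω : Fin N → Vec n) (x : Vec n) :
    ∃ i₀, x ∈ polarCone fun l => ω l - ω i₀ := by
  obtain ⟨i₀, hi₀⟩ := Finite.exists_max fun l => inner ℝ (ω l) x
  refine ⟨i₀, fun l => ?_⟩
  rw [inner_sub_left]
  linarith [hi₀ l]

/-- A facet's affine span is determined by the set of exponents on it, so the infimum runs over
finitely many positive distances. Nonemptiness matters because `sInf ∅ = 0`; it follows from the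
existence of an extreme ray. -/
theorem facetGap_pos (hω : ∃ i j, ω i ≠ ω j) : 0 < facetGap ω := by
  set S := {d : ℝ | ∃ (l : Fin N) (F : Set (Vec n)), IsFacet (newtonPolytope ω) F ∧ ω l ∉ F ∧
    d = Metric.infDist (ω l) (affineSpan ℝ F : Set (Vec n))} with hS
  have hface : ∀ F, IsFacet (newtonPolytope ω) F → ∃ (ℓ : StrongDual ℝ (Vec n)) (M : ℝ),
      (∀ i, ω i ∈ F ↔ ℓ (ω i) = M) ∧ (∀ p ∈ F, ℓ p = M) ∧
        affineSpan ℝ F = affineSpan ℝ (ω '' {i | ℓ (ω i) = M}) := by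
    rintro F ⟨hexp, hne, -⟩
    obtain ⟨p₀, hp₀⟩ := hne
    obtain ⟨ℓ, rfl⟩ := hexp ⟨p₀, hp₀⟩
    have hval : ∀ p ∈ {x ∈ newtonPolytope ω | ∀ y ∈ newtonPolytope ω, ℓ y ≤ ℓ x}, ℓ p = ℓ p₀ :=
      fun p hp => le_antisymm (hp₀.2 p hp.1) (hp.2 p₀ hp₀.1)
    have hiff : ∀ i, ω i ∈ {x ∈ newtonPolytope ω | ∀ y ∈ newtonPolytope ω, ℓ y ≤ ℓ x} ↔
        ℓ (ω i) = ℓ p₀ :=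
      fun i => ⟨hval _, fun h => ⟨mem_newtonPolytope ω i, fun y hy => h ▸ hp₀.2 y hy⟩⟩
    refine ⟨ℓ, ℓ p₀, hiff, hval, le_antisymm (affineSpan_le.2 fun p hp => ?_)
      (affineSpan_mono ℝ ?_)⟩
    · exact convexHull_subset_affineSpan _ (mem_convexHull_of_maximal ℓ.toLinearMap
        (fun i => hp₀.2 _ (mem_newtonPolytope ω i)) hp.1 (hval p hp).ge)
    · rintro _ ⟨i, hi, rfl⟩
      exact (hiff i).2 hi
  have hfin : S.Finite := by
    refine (Set.finite_range fun q : Fin N × Set (Fin N) =>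
      Metric.infDist (ω q.1) (affineSpan ℝ (ω '' q.2) : Set (Vec n))).subset ?_
    rintro _ ⟨l, F, hF, -, rfl⟩
    obtain ⟨ℓ, M, -, -, heq⟩ := hface F hF
    exact ⟨(l, _), by rw [heq]⟩
  have hpos : ∀ d ∈ S, 0 < d := by
    rintro _ ⟨l, F, hF, hl, rfl⟩
    obtain ⟨ℓ, M, hiff, hval, -⟩ := hface F hF
    refine ((AffineSubspace.closed_of_finiteDimensional _).notMem_iff_infDist_pos
      (hF.2.1.mono (subset_affineSpan ℝ F))).1 fun hmem => hl ((hiff l).2 ?_)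
    obtain ⟨p₀, hp₀⟩ := hF.2.1
    have hvs : ω l - p₀ ∈ vectorSpan ℝ F := by
      rw [← direction_affineSpan]
      exact AffineSubspace.vsub_mem_direction hmem (mem_affineSpan ℝ hp₀)
    have hker : vectorSpan ℝ F ≤ LinearMap.ker ℓ.toLinearMap := by
      refine Submodule.span_le.2 ?_
      rintro _ ⟨p, hp, q, hq, rfl⟩
      simp [hval p hp, hval q hq]
    have h0 : ℓ (ω l - p₀) = 0 := hker hvs
    rw [map_sub, hval p₀ hp₀] at h0
    linarith
  have hne : S.Nonempty := by
    obtain ⟨i, j, hij⟩ := hω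
    have : Nonempty (Fin N) := ⟨i⟩
    obtain ⟨i₀, hi₀⟩ := exists_mem_polarCone ω (ω i - ω j)
    have hmem : ω i - ω j ∈ Submodule.span ℝ (Set.range fun l => ω l - ω i₀) := by
      rw [← vectorSpan_range_eq]
      exact vsub_mem_vectorSpan ℝ (Set.mem_range_self i) (Set.mem_range_self j)
    obtain ⟨v, hv, -⟩ := exists_unitRay hmem (sub_ne_zero.2 hij) hi₀
    obtain ⟨l, hl⟩ := exists_inner_ne_zero hv.mem_span
      (norm_ne_zero_iff.1 (by rw [hv.norm_eq]; exact one_ne_zero))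
    exact ⟨_, l, _, hv.isFacet, fun h => hl ((mem_polytopeFace_iff hv.mem_polar).1 h), rfl⟩
  exact hpos _ (hne.csInf_mem hfin)

end Facets

/-! ### Log-sum-exp: smoothness, conjugate domain and short near-minimizers. -/

section GeometricProgram

variable {n N : ℕ} {c : Fin N → ℝ} {ω : Fin N → Vec n}

/-- The posynomial `∑ c_ℓ exp ⟨ω_ℓ, x⟩`. -/
noncomputable def gpSum (c : Fin N → ℝ) (ω : Fin N → Vec n) (x : Vec n) : ℝ :=
  ∑ l, c l * Real.exp (inner ℝ (ω l) x)

/-- The Gibbs weights `c_ℓ exp ⟨ω_ℓ, x⟩ / ∑ c_j exp ⟨ω_j, x⟩`. -/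
noncomputable def gpWeight (c : Fin N → ℝ) (ω : Fin N → Vec n) (x : Vec n) (l : Fin N) : ℝ :=
  c l * Real.exp (inner ℝ (ω l) x) / gpSum c ω x

/-- The mean of the exponents under the Gibbs weights. -/
noncomputable def gpMean (c : Fin N → ℝ) (ω : Fin N → Vec n) (x : Vec n) : Vec n :=
  ∑ l, gpWeight c ω x l • ω l

theorem gpSum_pos [Nonempty (Fin N)] (hc : ∀ l, 0 < c l) (x : Vec n) : 0 < gpSum c ω x :=
  Finset.sum_pos (fun l _ => mul_pos (hc l) (Real.exp_pos _)) Finset.univ_nonempty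

theorem gpWeight_nonneg (hc : ∀ l, 0 < c l) (x : Vec n) (l : Fin N) : 0 ≤ gpWeight c ω x l :=
  div_nonneg (mul_pos (hc l) (Real.exp_pos _)).le
    (Finset.sum_nonneg fun l _ => (mul_pos (hc l) (Real.exp_pos _)).le)

theorem sum_gpWeight [Nonempty (Fin N)] (hc : ∀ l, 0 < c l) (x : Vec n) :
    ∑ l, gpWeight c ω x l = 1 := by
  unfold gpWeight
  rw [← Finset.sum_div]
  exact div_self (gpSum_pos hc x).ne'

theorem gpMean_mem_newtonPolytope [Nonempty (Fin N)] (hc : ∀ l, 0 < c l) (x : Vec n) :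
    gpMean c ω x ∈ newtonPolytope ω :=
  (convex_convexHull ℝ _).sum_mem (fun l _ => gpWeight_nonneg hc x l) (sum_gpWeight hc x)
    fun l _ => mem_newtonPolytope ω l

theorem hasFDerivAt_gpSum (c : Fin N → ℝ) (ω : Fin N → Vec n) (x : Vec n) :
    HasFDerivAt (gpSum c ω)
      (∑ l, (c l * Real.exp (inner ℝ (ω l) x)) • innerSL ℝ (ω l)) x := by
  unfold gpSum
  refine HasFDerivAt.fun_sum fun l _ => ?_
  have h := (((innerSL ℝ (ω l)).hasFDerivAt (x := x)).exp).const_mul (c l)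
  simpa [smul_smul] using h

theorem hasGradientAt_gpObjective [Nonempty (Fin N)] (hc : ∀ l, 0 < c l) (x : Vec n) :
    HasGradientAt (gpObjective c ω) (gpMean c ω x) x := by
  rw [hasGradientAt_iff_hasFDerivAt]
  have h := (hasFDerivAt_gpSum c ω x).log (gpSum_pos hc x).ne'
  refine h.congr_fderiv ?_
  ext v
  simp only [gpMean, gpWeight, map_sum, map_smul, sum_apply,
    smul_apply, InnerProductSpace.toDual_apply_apply, innerSL_apply_apply,
    smul_eq_mul, Finset.mul_sum]
  refine Finset.sum_congr rfl fun l _ => ?_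
  ring

theorem gradient_gpObjective [Nonempty (Fin N)] (hc : ∀ l, 0 < c l) (x : Vec n) :
    gradient (gpObjective c ω) x = gpMean c ω x :=
  (hasGradientAt_gpObjective hc x).gradient

/-- Jensen's inequality for `exp` under the Gibbs weights at `x`, whose average of `exp ⟨ω_l, y -
x⟩` is the ratio of the two posynomials. -/
theorem add_inner_gpMean_le [Nonempty (Fin N)] (hc : ∀ l, 0 < c l) (x y : Vec n) :
    gpObjective c ω x + inner ℝ (gpMean c ω x) (y - x) ≤ gpObjective c ω y := by
  have hx := gpSum_pos (ω := ω) hc x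
  have hy := gpSum_pos (ω := ω) hc y
  have hjensen := convexOn_exp.map_sum_le (t := Finset.univ) (w := gpWeight c ω x)
    (p := fun l => inner ℝ (ω l) (y - x)) (fun l _ => gpWeight_nonneg hc x l)
    (sum_gpWeight hc x) (fun l _ => Set.mem_univ _)
  have hinner : inner ℝ (gpMean c ω x) (y - x) =
      ∑ l, gpWeight c ω x l • inner ℝ (ω l) (y - x) := by
    simp [gpMean, sum_inner, real_inner_smul_left]
  have hsum : ∑ l, gpWeight c ω x l • Real.exp (inner ℝ (ω l) (y - x)) =
      gpSum c ω y / gpSum c ω x := by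
    rw [gpSum, Finset.sum_div]
    refine Finset.sum_congr rfl fun l _ => ?_
    rw [gpWeight, inner_sub_right, Real.exp_sub, smul_eq_mul]
    field_simp
  rw [← hinner, hsum] at hjensen
  have h := (Real.le_log_iff_exp_le (div_pos hy hx)).2 hjensen
  rw [Real.log_div hy.ne' hx.ne'] at h
  change Real.log (gpSum c ω x) + _ ≤ Real.log (gpSum c ω y)
  linarith

theorem convexOn_gpObjective [Nonempty (Fin N)] (hc : ∀ l, 0 < c l) :
    ConvexOn ℝ Set.univ (gpObjective c ω) := by
  refine ⟨convex_univ, fun x _ y _ a b ha hb hab => ?_⟩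
  set z := a • x + b • y with hz
  have h1 := mul_le_mul_of_nonneg_left (add_inner_gpMean_le (ω := ω) hc z x) ha
  have h2 := mul_le_mul_of_nonneg_left (add_inner_gpMean_le (ω := ω) hc z y) hb
  have h0 : a * inner ℝ (gpMean c ω z) (x - z) + b * inner ℝ (gpMean c ω z) (y - z) = 0 := by
    rw [← real_inner_smul_right, ← real_inner_smul_right, ← inner_add_right]
    have : a • (x - z) + b • (y - z) = 0 := by
      have h3 : a • (x - z) + b • (y - z) = z - (a + b) • z := by
        rw [hz]; module
      rw [h3, hab, one_smul, sub_self]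
    rw [this, inner_zero_right]
  have h4 : gpObjective c ω z = a * gpObjective c ω z + b * gpObjective c ω z := by
    rw [← add_mul, hab, one_mul]
  simp only [smul_eq_mul]
  linarith

theorem norm_sq_le_gpSmoothness (ω : Fin N → Vec n) (l : Fin N) : ‖ω l‖ ^ 2 ≤ gpSmoothness ω :=
  le_ciSup (f := fun l => ‖ω l‖ ^ 2) (Set.finite_range _).bddAbove l

theorem gpSmoothness_pos (hω : ∃ i j, ω i ≠ ω j) : 0 < gpSmoothness ω := by
  obtain ⟨i, j, hij⟩ := hω
  by_contra! h
  have hz : ∀ l, ω l = 0 := fun l => by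
    have := (norm_sq_le_gpSmoothness ω l).trans h
    exact norm_eq_zero.1 (pow_eq_zero_iff two_ne_zero |>.1 (le_antisymm this (sq_nonneg _)))
  exact hij ((hz i).trans (hz j).symm)

theorem hasDerivAt_gpWeight [Nonempty (Fin N)] (hc : ∀ l, 0 < c l) (x d : Vec n) (l : Fin N)
    (t : ℝ) : HasDerivAt (fun t : ℝ => gpWeight c ω (x + t • d) l)
      (gpWeight c ω (x + t • d) l *
        (inner ℝ (ω l) d - inner ℝ (gpMean c ω (x + t • d)) d)) t := by
  have hline : HasDerivAt (fun t : ℝ => x + t • d) d t := by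
    simpa using ((hasDerivAt_id t).smul_const d).const_add x
  have hexp : HasDerivAt (fun t : ℝ => c l * Real.exp (inner ℝ (ω l) (x + t • d)))
      (c l * (Real.exp (inner ℝ (ω l) (x + t • d)) * inner ℝ (ω l) d)) t :=
    ((((innerSL ℝ (ω l)).hasFDerivAt (x := x + t • d)).comp_hasDerivAt t hline).exp).const_mul _
  have hsum : HasDerivAt (fun t : ℝ => gpSum c ω (x + t • d))
      (∑ l, c l * Real.exp (inner ℝ (ω l) (x + t • d)) * inner ℝ (ω l) d) t := by
    have h := (hasFDerivAt_gpSum c ω (x + t • d)).comp_hasDerivAt t hline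
    refine h.congr_deriv ?_
    simp [sum_apply]
  have hpos := gpSum_pos (ω := ω) hc (x + t • d)
  refine (hexp.div hsum hpos.ne').congr_deriv ?_
  have hmean : inner ℝ (gpMean c ω (x + t • d)) d =
      (∑ l, c l * Real.exp (inner ℝ (ω l) (x + t • d)) * inner ℝ (ω l) d) /
        gpSum c ω (x + t • d) := by
    simp only [gpMean, sum_inner, real_inner_smul_left, gpWeight, Finset.sum_div]
    exact Finset.sum_congr rfl fun l _ => by ring
  rw [hmean, gpWeight]
  field_simp

/-- The vector is the covariance of the Gibbs distribution applied to `d`. The mean absolute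
deviation of `⟨ω_l, d⟩` is at most its standard deviation, hence at most `√L ‖d‖`; the remaining
factor `ω l` costs another `√L`. -/
theorem norm_deriv_gpMean_le [Nonempty (Fin N)] (hc : ∀ l, 0 < c l) (x d : Vec n) :
    ‖∑ l, (gpWeight c ω x l * (inner ℝ (ω l) d - inner ℝ (gpMean c ω x) d)) • ω l‖ ≤
      gpSmoothness ω * ‖d‖ := by
  set w := gpWeight c ω x with hw
  have hw0 : ∀ l, 0 ≤ w l := gpWeight_nonneg hc x
  have hw1 : ∑ l, w l = 1 := sum_gpWeight hc x
  set L := gpSmoothness ω with hL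
  have hL0 : 0 ≤ L := (sq_nonneg _).trans (norm_sq_le_gpSmoothness ω (Classical.arbitrary _))
  set b : Fin N → ℝ := fun l => inner ℝ (ω l) d with hb
  set μ : ℝ := inner ℝ (gpMean c ω x) d with hμ
  have hμe : μ = ∑ l, w l * b l := by
    simp [hμ, gpMean, sum_inner, real_inner_smul_left, hw, hb]
  have hnorm : ∀ l, ‖ω l‖ ≤ √L := fun l => Real.le_sqrt_of_sq_le (norm_sq_le_gpSmoothness ω l)
  have hvar : ∑ l, w l * (b l - μ) ^ 2 ≤ L * ‖d‖ ^ 2 := by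
    have h1 : ∑ l, w l * (b l - μ) ^ 2 = ∑ l, w l * b l ^ 2 - μ ^ 2 := by
      have : ∀ l, w l * (b l - μ) ^ 2 = w l * b l ^ 2 - 2 * μ * (w l * b l) + μ ^ 2 * w l :=
        fun l => by ring
      simp only [this, Finset.sum_add_distrib, Finset.sum_sub_distrib, ← Finset.mul_sum, ← hμe, hw1]
      ring
    have h2 : ∑ l, w l * b l ^ 2 ≤ ∑ l, w l * (L * ‖d‖ ^ 2) := by
      refine Finset.sum_le_sum fun l _ => mul_le_mul_of_nonneg_left ?_ (hw0 l)
      have h3 : b l ^ 2 ≤ (‖ω l‖ * ‖d‖) ^ 2 := sq_le_sq' (neg_le_of_abs_le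
        (abs_real_inner_le_norm _ _)) (real_inner_le_norm _ _)
      rw [mul_pow] at h3
      exact h3.trans (mul_le_mul_of_nonneg_right (norm_sq_le_gpSmoothness ω l) (sq_nonneg _))
    rw [← Finset.sum_mul, hw1, one_mul] at h2
    linarith [sq_nonneg μ]
  have habs : ∑ l, w l * |b l - μ| ≤ √L * ‖d‖ := by
    refine le_of_sq_le_sq ?_ (by positivity)
    rw [mul_pow, Real.sq_sqrt hL0]
    refine le_trans ?_ hvar
    have := (convexOn_pow 2 (𝕜 := ℝ)).map_sum_le (t := Finset.univ) (w := w)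
      (p := fun l => |b l - μ|) (fun l _ => hw0 l) hw1 (fun l _ => Set.mem_Ici.2 (abs_nonneg _))
    simpa using this
  calc _ ≤ ∑ l, w l * |b l - μ| * √L := by
        refine (norm_sum_le _ _).trans (Finset.sum_le_sum fun l _ => ?_)
        rw [norm_smul, norm_mul, Real.norm_eq_abs, Real.norm_eq_abs, abs_of_nonneg (hw0 l)]
        exact mul_le_mul_of_nonneg_left (hnorm l) (mul_nonneg (hw0 l) (abs_nonneg _))
    _ ≤ √L * ‖d‖ * √L := by
        rw [← Finset.sum_mul]
        exact mul_le_mul_of_nonneg_right habs (Real.sqrt_nonneg _)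
    _ = L * ‖d‖ := by
        rw [mul_right_comm, Real.mul_self_sqrt hL0]

theorem isSmoothConvex_gpObjective (hc : ∀ l, 0 < c l) (hω : ∃ i j, ω i ≠ ω j) :
    IsSmoothConvex (gpSmoothness ω) (gpObjective c ω) := by
  have : Nonempty (Fin N) := hω.nonempty
  refine ⟨gpSmoothness_pos hω, convexOn_gpObjective hc,
    fun x => (hasGradientAt_gpObjective hc x).differentiableAt, fun y x => ?_⟩
  rw [gradient_gpObjective hc, gradient_gpObjective hc]
  have hderiv : ∀ t : ℝ, HasDerivAt (fun t : ℝ => gpMean c ω (x + t • (y - x)))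
      (∑ l, (gpWeight c ω (x + t • (y - x)) l *
        (inner ℝ (ω l) (y - x) - inner ℝ (gpMean c ω (x + t • (y - x))) (y - x))) • ω l) t :=
    fun t => HasDerivAt.fun_sum fun l _ => (hasDerivAt_gpWeight hc x (y - x) l t).smul_const _
  have h := norm_image_sub_le_of_norm_deriv_le_segment_01' (fun t _ => (hderiv t).hasDerivWithinAt)
    (fun t _ => norm_deriv_gpMean_le hc (x + t • (y - x)) (y - x))
  simpa using h

theorem inner_le_gpObjective [Nonempty (Fin N)] (hc : ∀ l, 0 < c l) {p : Vec n}
    (hp : p ∈ newtonPolytope ω) (x : Vec n) :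
    Real.log (⨅ l, c l) + inner ℝ p x ≤ gpObjective c ω x := by
  obtain ⟨i₀, hi₀⟩ := Finite.exists_max fun l => inner ℝ (ω l) x
  obtain ⟨j, hj⟩ := exists_eq_ciInf_of_finite (f := c)
  have hmin : 0 < ⨅ l, c l := hj ▸ hc j
  have hinner := inner_le_of_mem_newtonPolytope hi₀ hp
  have hle : (⨅ l, c l) * Real.exp (inner ℝ p x) ≤ gpSum c ω x := by
    refine le_trans ?_ (Finset.single_le_sum (f := fun l => c l * Real.exp (inner ℝ (ω l) x))
      (fun l _ => (mul_pos (hc l) (Real.exp_pos _)).le) (Finset.mem_univ i₀))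
    exact mul_le_mul (ciInf_le (Set.finite_range c).bddBelow i₀) (Real.exp_le_exp.2 hinner)
      (Real.exp_pos _).le (hc i₀).le
  have h := Real.log_le_log (mul_pos hmin (Real.exp_pos _)) hle
  rwa [Real.log_mul hmin.ne' (Real.exp_pos _).ne', Real.log_exp] at h

/-- Outside the polytope a separating direction `d` makes `⟨p, t d⟩ - f(t d)` grow linearly in `t`.
Inside, the largest exponential term alone bounds the conjugate. -/
theorem conjugateDomain_gpObjective [Nonempty (Fin N)] (hc : ∀ l, 0 < c l) :
    conjugateDomain (gpObjective c ω) = newtonPolytope ω := by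
  apply Set.Subset.antisymm
  · intro p hp
    by_contra hpn
    obtain ⟨ℓ, s, hs, hsp⟩ := geometric_hahn_banach_closed_point (convex_convexHull ℝ _)
      ((Set.finite_range ω).isClosed_convexHull ℝ) hpn
    set d := (InnerProductSpace.toDual ℝ (Vec n)).symm ℓ with hd
    have hdl : ∀ q, inner ℝ q d = ℓ q := fun q => by
      rw [real_inner_comm, hd, InnerProductSpace.toDual_symm_apply]
    obtain ⟨B, hB, -⟩ := EReal.lt_iff_exists_real_btwn.1 (show fenchelConjugate _ p < ⊤ from hp)
    have hbd : ∀ x : Vec n, inner ℝ p x - gpObjective c ω x ≤ B := fun x => by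
      have := (le_iSup (fun x : Vec n => ((inner ℝ p x - gpObjective c ω x : ℝ) : EReal)) x).trans
        hB.le
      exact_mod_cast this
    have hC : 0 < ∑ l, c l := Finset.sum_pos (fun l _ => hc l) Finset.univ_nonempty
    have hup : ∀ t : ℝ, 0 ≤ t → gpObjective c ω (t • d) ≤ Real.log (∑ l, c l) + t * s := by
      intro t ht
      have h1 : gpSum c ω (t • d) ≤ (∑ l, c l) * Real.exp (t * s) := by
        rw [gpSum, Finset.sum_mul]
        refine Finset.sum_le_sum fun l _ => mul_le_mul_of_nonneg_left ?_ (hc l).le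
        rw [real_inner_smul_right, hdl]
        exact Real.exp_le_exp.2 (mul_le_mul_of_nonneg_left (hs _ (mem_newtonPolytope ω l)).le ht)
      have h2 := Real.log_le_log (gpSum_pos hc _) h1
      rwa [Real.log_mul hC.ne' (Real.exp_pos _).ne', Real.log_exp] at h2
    -- Chosen so that `t (ℓ p - s)` exceeds `B + log ∑ c_l`, the bound implied by finiteness of the
    -- conjugate.
    set t : ℝ := (|B| + |Real.log (∑ l, c l)| + 1) / (ℓ p - s) with ht
    have hgap : 0 < ℓ p - s := sub_pos.2 hsp
    have ht0 : 0 ≤ t := by positivity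
    have h1 := hbd (t • d)
    rw [real_inner_smul_right, hdl] at h1
    have h2 := hup t ht0
    have h3 : t * (ℓ p - s) = |B| + |Real.log (∑ l, c l)| + 1 := by
      rw [ht]; field_simp
    linarith [le_abs_self B, le_abs_self (Real.log (∑ l, c l))]
  · intro p hp
    refine lt_of_le_of_lt (iSup_le fun x => ?_) (EReal.coe_lt_top (-Real.log (⨅ l, c l)))
    have := inner_le_gpObjective hc hp x
    exact_mod_cast (by linarith : inner ℝ p x - gpObjective c ω x ≤ -Real.log (⨅ l, c l))

theorem closure_conjugateDomain_gpObjective [Nonempty (Fin N)] (hc : ∀ l, 0 < c l) :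
    closure (conjugateDomain (gpObjective c ω)) = newtonPolytope ω := by
  rw [conjugateDomain_gpObjective hc]
  exact ((Set.finite_range ω).isClosed_convexHull ℝ).closure_eq

theorem inner_sub_minNormPoint_nonneg {p q : Vec n} (hp : IsMinNormPoint p (newtonPolytope ω))
    (hq : q ∈ newtonPolytope ω) : 0 ≤ inner ℝ (q - p) p := by
  have hconv : Convex ℝ (newtonPolytope ω) := convex_convexHull ℝ _
  have : Nonempty (newtonPolytope ω) := ⟨⟨p, hp.1⟩⟩
  have hinf : ‖(0 : Vec n) - p‖ = ⨅ w : newtonPolytope ω, ‖(0 : Vec n) - w‖ := by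
    refine le_antisymm (le_ciInf fun w => ?_) (ciInf_le ⟨0, ?_⟩ (⟨p, hp.1⟩ : newtonPolytope ω))
    · simpa using hp.2 w w.2
    · rintro _ ⟨w, rfl⟩
      exact norm_nonneg _
  have h := (norm_eq_iInf_iff_real_inner_le_zero hconv hp.1).1 hinf q hq
  rw [zero_sub, inner_neg_left, real_inner_comm] at h
  linarith

/-- Near-minimizers of the tilted objective in a ball of logarithmic radius. -/
theorem exists_tilt_le (hc : ∀ l, 0 < c l) (hω : ∃ i j, ω i ≠ ω j) {p : Vec n}
    (hp : p ∈ newtonPolytope ω) {δ : ℝ} (hδ : 0 < δ) (hδβ : δ ≤ gpBeta c) (x : Vec n) :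
    ∃ u, ‖u‖ ≤ affDim (Set.range ω) / facetGap ω * Real.log (gpBeta c / δ) ∧
      tilt (gpObjective c ω) p u ≤ tilt (gpObjective c ω) p x + δ := by
  have : Nonempty (Fin N) := hω.nonempty
  have hφ := facetGap_pos hω
  set φ := facetGap ω with hφe
  set β := gpBeta c with hβe
  have hβ : 0 < β := hδ.trans_le hδβ
  set T := Real.log (β / δ) / φ with hTe
  have hT : 0 ≤ T := div_nonneg (Real.log_nonneg ((one_le_div hδ).2 hδβ)) hφ.le
  set V := vectorSpan ℝ (Set.range ω) with hV
  -- The component `x₂` is invisible to `g`, since every `ω l - p` lies in `V`.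
  obtain ⟨x₁, hx₁, x₂, hx₂, hx⟩ := V.exists_add_mem_mem_orthogonal x
  obtain ⟨i₀, hi₀⟩ := exists_mem_polarCone ω x₁
  set a : Fin N → Vec n := fun l => ω l - ω i₀ with ha
  have hVa : V = Submodule.span ℝ (Set.range a) := vectorSpan_range_eq ω i₀
  have hgap : ∀ v, IsUnitRay a v → ∀ l, inner ℝ (a l) v = 0 ∨ inner ℝ (a l) v ≤ -φ := by
    intro v hv l
    by_cases h : inner ℝ (a l) v = 0
    · exact Or.inl h
    · right
      have := hv.facetGap_le h
      linarith
  obtain ⟨u, hu, huN, hxu, hul⟩ := exists_truncation hT hgap (hVa ▸ hx₁) hi₀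
  have hle : ∀ l, inner ℝ (ω l) (x₁ - u) ≤ inner ℝ (ω i₀) (x₁ - u) := fun l => by
    have := hxu l
    rw [ha, inner_sub_left] at this
    linarith
  have hpu : inner ℝ p (x₁ - u) ≤ inner ℝ (ω i₀) (x₁ - u) := inner_le_of_mem_newtonPolytope hle hp
  have hperp : ∀ l, inner ℝ (ω l - p) x = inner ℝ (ω l - p) x₁ := fun l => by
    have hmem : ω l - p ∈ V := by
      rw [hV, ← direction_affineSpan]
      exact AffineSubspace.vsub_mem_direction (mem_affineSpan ℝ (Set.mem_range_self l))
        (convexHull_subset_affineSpan _ hp)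
    rw [hx, inner_add_right, Submodule.inner_right_of_mem_orthogonal hmem hx₂, add_zero]
  -- For these indices passing from `x` to `u` does not increase the term: `ω l` attains the maximum
  -- of `⟨·, x₁ - u⟩` over the polytope, which is at least the value at `p`.
  have hgood : ∀ l, inner ℝ (a l) (x₁ - u) = 0 →
      inner ℝ (ω l - p) u ≤ inner ℝ (ω l - p) x := fun l hl => by
    rw [hperp]
    simp only [ha, inner_sub_left, inner_sub_right] at hl hpu ⊢
    linarith
  have hgood₀ : inner ℝ (ω i₀ - p) u ≤ inner ℝ (ω i₀ - p) x := hgood i₀ (by simp [ha])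
  obtain ⟨j, hj⟩ := exists_eq_ciInf_of_finite (f := c)
  have hmin : 0 < ⨅ l, c l := hj ▸ hc j
  -- The other terms at `u` are damped by `e^{-φT} = δ/β` relative to the `i₀` term.
  have hexp : ∀ l, inner ℝ (a l) u ≤ -(φ * T) →
      Real.exp (inner ℝ (ω l - p) u) ≤ δ / β * Real.exp (inner ℝ (ω i₀ - p) x) := fun l hl => by
    have h1 : δ / β = Real.exp (-(φ * T)) := by
      rw [hTe, mul_div_cancel₀ _ hφ.ne', ← Real.log_inv, inv_div, Real.exp_log (div_pos hδ hβ)]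
    rw [h1, ← Real.exp_add]
    refine Real.exp_le_exp.2 ?_
    simp only [ha, inner_sub_left] at hl hgood₀ ⊢
    linarith
  have hshift : ∀ y, ∑ l, c l * Real.exp (inner ℝ (ω l - p) y) =
      gpSum c ω y * Real.exp (-inner ℝ p y) := fun y => by
    rw [gpSum, Finset.sum_mul]
    refine Finset.sum_congr rfl fun l _ => ?_
    rw [inner_sub_left, sub_eq_add_neg, Real.exp_add, mul_assoc]
  have hterm : ∀ l, c l * Real.exp (inner ℝ (ω l - p) u) ≤ c l * Real.exp (inner ℝ (ω l - p) x) +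
      c l * (δ / β * Real.exp (inner ℝ (ω i₀ - p) x)) := fun l => by
    rw [← mul_add]
    refine mul_le_mul_of_nonneg_left ?_ (hc l).le
    rcases hul l with h | h
    · exact (Real.exp_le_exp.2 (hgood l h)).trans (le_add_of_nonneg_right (by positivity))
    · exact (hexp l h).trans (le_add_of_nonneg_left (Real.exp_pos _).le)
  -- This is what `β` is for: all damped terms together cost at most `δ` times the `i₀` term of the
  -- sum at `x`.
  have hcβ : (∑ l, c l) * (δ / β) = δ * ⨅ l, c l := by
    have hC : 0 < ∑ l, c l := Finset.sum_pos (fun l _ => hc l) Finset.univ_nonempty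
    rw [hβe, gpBeta]
    field_simp
  have hi₀x : (⨅ l, c l) * Real.exp (inner ℝ (ω i₀ - p) x) ≤
      ∑ l, c l * Real.exp (inner ℝ (ω l - p) x) :=
    (mul_le_mul_of_nonneg_right (ciInf_le (Set.finite_range c).bddBelow i₀)
      (Real.exp_pos _).le).trans
      (Finset.single_le_sum (f := fun l => c l * Real.exp (inner ℝ (ω l - p) x))
        (fun l _ => (mul_pos (hc l) (Real.exp_pos _)).le) (Finset.mem_univ i₀))
  have hsum : ∑ l, c l * Real.exp (inner ℝ (ω l - p) u) ≤
      (1 + δ) * ∑ l, c l * Real.exp (inner ℝ (ω l - p) x) := by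
    refine (Finset.sum_le_sum fun l _ => hterm l).trans ?_
    rw [Finset.sum_add_distrib, ← Finset.sum_mul, ← mul_assoc, hcβ, mul_assoc]
    nlinarith
  have htilt : ∀ y, tilt (gpObjective c ω) p y =
      Real.log (∑ l, c l * Real.exp (inner ℝ (ω l - p) y)) := fun y => by
    rw [hshift, Real.log_mul (gpSum_pos hc y).ne' (Real.exp_pos _).ne', Real.log_exp]
    rfl
  have hpos : ∀ y, 0 < ∑ l, c l * Real.exp (inner ℝ (ω l - p) y) := fun y =>
    Finset.sum_pos (fun l _ => mul_pos (hc l) (Real.exp_pos _)) Finset.univ_nonempty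
  refine ⟨u, hu.trans ?_, ?_⟩
  · have h1 : (Module.finrank ℝ (Submodule.span ℝ (Set.range a)) : ℝ) = affDim (Set.range ω) := by
      rw [← hVa, affDim]
    rw [h1, hTe, div_mul_eq_mul_div, ← mul_div_assoc]
    refine div_le_div_of_nonneg_right (mul_le_mul_of_nonneg_right ?_ ?_) hφ.le
    · linarith [Nat.cast_nonneg (α := ℝ) (Module.finrank ℝ (tightSpan a x₁))]
    · exact Real.log_nonneg ((one_le_div hδ).2 hδβ)
  · rw [htilt, htilt]
    refine (Real.log_le_log (hpos u) hsum).trans ?_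
    rw [Real.log_mul (by positivity) (hpos x).ne']
    linarith [Real.log_le_sub_one_of_pos (show 0 < 1 + δ by positivity)]

end GeometricProgram

/-! ### The accelerated method on a tilted objective. -/

section AcceleratedGradient

variable {n : ℕ} {f : Vec n → ℝ} {L : ℝ}

namespace IsSmoothConvex

theorem hasDerivAt_line (hf : IsSmoothConvex L f) (x d : Vec n) (t : ℝ) :
    HasDerivAt (fun t : ℝ => f (x + t • d)) (inner ℝ (gradient f (x + t • d)) d) t := by
  have hline : HasDerivAt (fun t : ℝ => x + t • d) d t := by
    simpa using ((hasDerivAt_id t).smul_const d).const_add x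
  have h := (hf.differentiable (x + t • d)).hasGradientAt.hasFDerivAt.comp_hasDerivAt t hline
  refine h.congr_deriv ?_
  simp

theorem add_inner_gradient_le (hf : IsSmoothConvex L f) (x y : Vec n) :
    f x + inner ℝ (gradient f x) (y - x) ≤ f y := by
  have hconv : ConvexOn ℝ Set.univ (fun t : ℝ => f (x + t • (y - x))) := by
    have h := hf.convex.comp_affineMap (AffineMap.lineMap x y)
    simpa [Function.comp_def, AffineMap.lineMap_apply, add_comm] using h
  have h := hconv.le_slope_of_hasDerivAt (Set.mem_univ 0) (Set.mem_univ 1) one_pos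
    (hf.hasDerivAt_line x (y - x) 0)
  simp only [slope_def_field, zero_smul, one_smul, add_zero, add_sub_cancel, sub_zero, div_one] at h
  linarith

theorem le_add_inner_add_norm_sq (hf : IsSmoothConvex L f) (x y : Vec n) :
    f y ≤ f x + inner ℝ (gradient f x) (y - x) + L / 2 * ‖y - x‖ ^ 2 := by
  set d := y - x with hd
  set ψ : ℝ → ℝ := fun t => f (x + t • d) - t * inner ℝ (gradient f x) d -
    L / 2 * ‖d‖ ^ 2 * t ^ 2 with hψ
  have hderiv : ∀ t, HasDerivAt ψ (inner ℝ (gradient f (x + t • d)) d -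
      inner ℝ (gradient f x) d - L * ‖d‖ ^ 2 * t) t := fun t => by
    refine (((hf.hasDerivAt_line x d t).sub ((hasDerivAt_id t).mul_const _)).sub
      ((hasDerivAt_pow 2 t).const_mul _)).congr_deriv ?_
    simp
    ring
  have hanti : AntitoneOn ψ (Set.Ici 0) := by
    refine antitoneOn_of_hasDerivWithinAt_nonpos (convex_Ici 0)
      (fun t _ => (hderiv t).continuousAt.continuousWithinAt)
      (fun t _ => (hderiv t).hasDerivWithinAt) fun t ht => ?_
    rw [interior_Ici] at ht
    have h1 := hf.lipschitz (x + t • d) x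
    rw [add_sub_cancel_left, norm_smul, Real.norm_eq_abs, abs_of_pos ht] at h1
    have h2 := real_inner_le_norm (gradient f (x + t • d) - gradient f x) d
    rw [inner_sub_left] at h2
    nlinarith [mul_le_mul_of_nonneg_right h1 (norm_nonneg d)]
  have h := hanti (Set.mem_Ici.2 le_rfl) (Set.mem_Ici.2 zero_le_one) zero_le_one
  have hxd : x + d = y := by rw [hd]; abel
  simp only [hψ, one_smul, zero_smul, add_zero, hxd] at h
  linarith

theorem tilt_add_inner_le (hf : IsSmoothConvex L f) (p x y : Vec n) :
    tilt f p x + inner ℝ (gradient f x - p) (y - x) ≤ tilt f p y := by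
  have h := hf.add_inner_gradient_le x y
  simp only [tilt, inner_sub_left, inner_sub_right] at h ⊢
  linarith

theorem tilt_le_add_inner (hf : IsSmoothConvex L f) (p x y : Vec n) :
    tilt f p y ≤ tilt f p x + inner ℝ (gradient f x - p) (y - x) + L / 2 * ‖y - x‖ ^ 2 := by
  have h := hf.le_add_inner_add_norm_sq x y
  simp only [tilt, inner_sub_left, inner_sub_right] at h ⊢
  linarith

theorem norm_gradient_sq_le (hf : IsSmoothConvex L f) {p : Vec n}
    (hbdd : BddBelow (Set.range (tilt f p))) (x : Vec n) :
    ‖gradient f x - p‖ ^ 2 / (2 * L) ≤ tilt f p x - ⨅ u, tilt f p u := by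
  have hL := hf.pos
  set v := gradient f x - p with hv
  have h := hf.tilt_le_add_inner p x (x - L⁻¹ • v)
  have h1 := ciInf_le hbdd (x - L⁻¹ • v)
  have h2 : x - L⁻¹ • v - x = -(L⁻¹ • v) := by abel
  rw [h2, inner_neg_right, real_inner_smul_right, real_inner_self_eq_norm_sq, norm_neg, norm_smul,
    mul_pow, Real.norm_eq_abs, sq_abs] at h
  have h3 : ‖v‖ ^ 2 / (2 * L) = L⁻¹ * ‖v‖ ^ 2 - L / 2 * (L⁻¹ ^ 2 * ‖v‖ ^ 2) := by
    field_simp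
    ring
  linarith

/-- If `⟨∇f - p, p⟩ ≥ 0` everywhere, the tilted function decreases in the direction `-p`. -/
theorem tilt_sub_smul_le (hf : IsSmoothConvex L f) {p : Vec n}
    (hp : ∀ x, 0 ≤ inner ℝ (gradient f x - p) p) (x : Vec n) {t : ℝ} (ht : 0 ≤ t) :
    tilt f p (x - t • p) ≤ tilt f p x := by
  have h := hf.tilt_add_inner_le p (x - t • p) x
  rw [sub_sub_cancel, real_inner_smul_right] at h
  linarith [mul_nonneg ht (hp (x - t • p))]

end IsSmoothConvex

variable {A : ℕ → ℝ} {x₀ : Vec n} {x y z : ℕ → Vec n}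

theorem StepSizeCondition.nonneg (hA : StepSizeCondition L A) (k : ℕ) : 0 ≤ A k := by
  rw [← hA.zero]
  exact monotone_nat_of_le_succ (fun k => (sub_pos.1 (hA.pos k)).le) (Nat.zero_le k)

theorem StepSizeCondition.succ_pos (hA : StepSizeCondition L A) (k : ℕ) : 0 < A (k + 1) :=
  (hA.nonneg k).trans_lt (sub_pos.1 (hA.pos k))

theorem StepSizeCondition.sq_le (hA : StepSizeCondition L A) (hL : 0 < L) (k : ℕ) :
    L * stepDiff A k ^ 2 ≤ 4 * A (k + 1) := by
  have h := pow_le_pow_left₀ (hA.pos k).le (hA.le k) 2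
  rw [mul_pow, Real.sq_sqrt (div_nonneg (hA.succ_pos k).le hL.le)] at h
  calc L * stepDiff A k ^ 2 ≤ L * (2 ^ 2 * (A (k + 1) / L)) := mul_le_mul_of_nonneg_left h hL.le
    _ = 4 * A (k + 1) := by field_simp; ring

/-- Define `z` by accumulating gradients. The remaining relations interlock: the `y` relation at `k`
gives the `x` relation at `k`, which gives the `y` relation at `k + 1`. -/
theorem IsAGMTwo.exists_three (hA : StepSizeCondition L A) (h : IsAGMTwo f A x₀ x y) :
    ∃ z, IsAGMThree f A x₀ x y z := by
  let z : ℕ → Vec n := fun k => Nat.rec x₀ (fun k w => w - (stepDiff A k / 4) • gradient f (y k)) k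
  have hz : ∀ k, z (k + 1) = z k - (stepDiff A k / 4) • gradient f (y k) := fun k => rfl
  have hx : ∀ k, y k - x k = (stepDiff A k / A (k + 1)) • (z k - x k) →
      A k • (x (k + 1) - x k) = stepDiff A k • (z (k + 1) - x (k + 1)) := by
    intro k hy
    have hA1 := (hA.succ_pos k).ne'
    have hyk : y k = x k + (stepDiff A k / A (k + 1)) • (z k - x k) := by rw [← hy]; abel
    have hxk : x (k + 1) = x k + (stepDiff A k / A (k + 1)) • (z (k + 1) - x k) := by
      rw [h.x_step, hz, hyk]
      match_scalars <;> field_simp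
    have hkey : A (k + 1) • (x (k + 1) - x k) = stepDiff A k • (z (k + 1) - x k) := by
      rw [hxk, add_sub_cancel_left, smul_smul, mul_div_cancel₀ _ hA1]
    have hAk : A k = A (k + 1) - stepDiff A k := by rw [stepDiff]; ring
    rw [hAk, sub_smul, hkey]
    module
  have hy : ∀ k, y k - x k = (stepDiff A k / A (k + 1)) • (z k - x k) := by
    intro k
    induction k with
    | zero =>
      have : z 0 = x₀ := rfl
      rw [h.y_zero, h.x_zero, this, sub_self, smul_zero]
    | succ k ih =>
      have hd := (hA.pos k).ne'
      rw [h.y_step, add_sub_cancel_left]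
      have h1 : A k * stepDiff A (k + 1) / (A (k + 2) * stepDiff A k) =
          stepDiff A (k + 1) / A (k + 2) * (stepDiff A k)⁻¹ * A k := by
        field_simp
      rw [h1, mul_smul, hx k ih, smul_smul, mul_assoc, inv_mul_cancel₀ hd, mul_one]
  exact ⟨z, h.x_zero, rfl, hy, fun k => by rw [hz]; abel, fun k => hx k (hy k)⟩

/-- The Lyapunov function of the accelerated gradient method, with the comparison point moving
along `-p`, does not increase. -/
theorem IsAGMThree.energy_succ_le (hf : IsSmoothConvex L f) (hA : StepSizeCondition L A)
    (h : IsAGMThree f A x₀ x y z) {p : Vec n} (hp : ∀ x, 0 ≤ inner ℝ (gradient f x - p) p)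
    (u : Vec n) (k : ℕ) :
    A (k + 1) * (tilt f p (x (k + 1)) - tilt f p u) + 2 * ‖z (k + 1) + (A (k + 1) / 4) • p - u‖ ^ 2
      ≤ A k * (tilt f p (x k) - tilt f p u) + 2 * ‖z k + (A k / 4) • p - u‖ ^ 2 := by
  set δ := stepDiff A k with hδ
  set v := gradient f (y k) - p with hv
  have hA1 := hA.succ_pos k
  have hA0 := hA.nonneg k
  have hδ0 : 0 < δ := hA.pos k
  have hAk : A (k + 1) = A k + δ := by rw [hδ, stepDiff]; ring
  set s := δ ^ 2 / (4 * A (k + 1)) with hs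
  have hs0 : 0 ≤ s := by positivity
  have hyk : A (k + 1) • (y k - x k) = δ • (z k - x k) := by
    rw [h.y_step, smul_smul, mul_div_cancel₀ _ hA1.ne']
  have hzk : z (k + 1) = z k - (δ / 4) • gradient f (y k) := by
    have := h.z_step k
    rw [sub_eq_iff_eq_add] at this
    rw [this]; abel
  -- A gradient step for `f` is one for `g` followed by a shift along `-p`, which does not increase
  -- `g`.
  have hxk : x (k + 1) = y k - s • v - s • p := by
    have h1 : A (k + 1) • x (k + 1) = A (k + 1) • (y k - s • v - s • p) := by
      have h2 := h.x_step k
      have h3 : A (k + 1) • x (k + 1) = A k • x k + δ • z (k + 1) := by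
        rw [hAk, add_smul]
        rw [smul_sub, smul_sub, sub_eq_sub_iff_add_eq_add] at h2
        rw [h2]; abel
      have h4 : A (k + 1) • y k = A k • x k + δ • z k := by
        rw [smul_sub, smul_sub, sub_eq_iff_eq_add] at hyk
        rw [hyk, hAk]; module
      have h5 : A (k + 1) * s = δ * (δ / 4) := by rw [hs]; field_simp
      rw [h3, hzk, sub_sub, ← smul_add, hv, sub_add_cancel, smul_sub (A (k + 1)), h4, smul_smul, h5]
      module
    exact smul_right_injective _ hA1.ne' h1
  have hdesc : tilt f p (x (k + 1)) ≤ tilt f p (y k) - s * ‖v‖ ^ 2 + L / 2 * (s ^ 2 * ‖v‖ ^ 2) := by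
    rw [hxk]
    refine (hf.tilt_sub_smul_le hp _ hs0).trans ((hf.tilt_le_add_inner p (y k) _).trans_eq ?_)
    have h2 : y k - s • v - y k = -(s • v) := by abel
    rw [h2, ← hv, inner_neg_right, real_inner_smul_right, real_inner_self_eq_norm_sq, norm_neg,
      norm_smul, mul_pow, Real.norm_eq_abs, sq_abs]
    ring
  have hx := hf.tilt_add_inner_le p (y k) (x k)
  have hu := hf.tilt_add_inner_le p (y k) u
  rw [← hv] at hx hu
  set w := z k + (A k / 4) • p - u with hw
  have hznext : z (k + 1) + (A (k + 1) / 4) • p - u = w - (δ / 4) • v := by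
    rw [hzk, hw, hv, hAk]; module
  have hnorm : ‖w - (δ / 4) • v‖ ^ 2 = ‖w‖ ^ 2 - δ / 2 * inner ℝ v w + δ ^ 2 / 16 * ‖v‖ ^ 2 := by
    rw [norm_sub_sq_real, norm_smul, real_inner_smul_right, real_inner_comm, mul_pow,
      Real.norm_eq_abs, sq_abs]
    ring
  -- The drift of the comparison point leaves only the extra term `(δ A_k/4) ⟨v, p⟩`, of favourable
  -- sign by `hp`.
  have hcomb : A k * inner ℝ v (x k - y k) + δ * inner ℝ v (u - y k) =
      -(δ * inner ℝ v w) + δ * A k / 4 * inner ℝ v p := by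
    have h1 : A k • (x k - y k) + δ • (u - y k) = -(δ • w) + (δ * A k / 4) • p := by
      have h4 : A (k + 1) • y k = A k • x k + δ • z k := by
        rw [smul_sub, smul_sub, sub_eq_iff_eq_add] at hyk
        rw [hyk, hAk]; module
      have h5 : A k • (x k - y k) + δ • (u - y k) = A k • x k + δ • u - A (k + 1) • y k := by
        rw [hAk]; module
      rw [h5, h4, hw]; module
    have h2 := congrArg (fun q => inner ℝ v q) h1
    simpa [inner_add_right, inner_neg_right, real_inner_smul_right] using h2
  have hvp : 0 ≤ δ * A k / 4 * inner ℝ v p := mul_nonneg (by positivity) (hp _)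
  -- The step-size condition lets the curvature term consume at most half of the decrease `δ²/4
  -- ‖v‖²`; the other half cancels the `‖v‖²` term of the squared distance.
  have hstep : A (k + 1) * (L / 2 * (s ^ 2 * ‖v‖ ^ 2)) ≤ δ ^ 2 / 8 * ‖v‖ ^ 2 := by
    have h1 : A (k + 1) * (L / 2 * (s ^ 2 * ‖v‖ ^ 2)) =
        L * δ ^ 2 / (4 * A (k + 1)) * (δ ^ 2 / 8 * ‖v‖ ^ 2) := by
      rw [hs]; field_simp; ring
    rw [h1]
    refine mul_le_of_le_one_left (by positivity) ((div_le_one (by positivity)).2 ?_)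
    exact hA.sq_le hf.pos k
  have hs4 : A (k + 1) * (s * ‖v‖ ^ 2) = δ ^ 2 / 4 * ‖v‖ ^ 2 := by rw [hs]; field_simp
  rw [hznext, hnorm]
  have h1 := mul_le_mul_of_nonneg_left hdesc hA1.le
  have h2 := mul_le_mul_of_nonneg_left hx hA0
  have h3 := mul_le_mul_of_nonneg_left hu hδ0.le
  have h4 : A (k + 1) * tilt f p (y k) = A k * tilt f p (y k) + δ * tilt f p (y k) := by
    rw [hAk]; ring
  have h5 : A (k + 1) * tilt f p u = A k * tilt f p u + δ * tilt f p u := by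
    rw [hAk]; ring
  linarith

theorem IsAGMIterates.tilt_sub_le (hf : IsSmoothConvex L f) (hA : StepSizeCondition L A)
    (h : IsAGMIterates f A x₀ x) {p : Vec n} (hp : ∀ x, 0 ≤ inner ℝ (gradient f x - p) p)
    (u : Vec n) (k : ℕ) : A k * (tilt f p (x k) - tilt f p u) ≤ 2 * ‖x₀ - u‖ ^ 2 := by
  obtain ⟨y, z, h⟩ : ∃ y z, IsAGMThree f A x₀ x y z := by
    rcases h with ⟨y, h⟩ | h
    exacts [⟨y, h.exists_three hA⟩, h]
  have henergy : A k * (tilt f p (x k) - tilt f p u) + 2 * ‖z k + (A k / 4) • p - u‖ ^ 2 ≤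
      2 * ‖x₀ - u‖ ^ 2 := by
    induction k with
    | zero => simp [hA.zero, h.z_zero]
    | succ k ih => exact (h.energy_succ_le hf hA hp u k).trans ih
  linarith [sq_nonneg ‖z k + (A k / 4) • p - u‖]

end AcceleratedGradient

/-! ### Quadratic growth of `A` and the asymptotic order of the bound. -/

section Rate

theorem StepSizeCondition.exists_quadratic_bounds {L : ℝ} {A : ℕ → ℝ}
    (hA : StepSizeCondition L A) : ∃ a b : ℝ, 0 < a ∧ 0 < b ∧
      ∀ᶠ k : ℕ in atTop, a * (k : ℝ) ^ 2 ≤ A k ∧ A k ≤ b * (k : ℝ) ^ 2 := by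
  obtain ⟨C, hC, hup⟩ := hA.theta.1.exists_pos
  obtain ⟨D, hD, hlow⟩ := hA.theta.2.exists_pos
  obtain ⟨K, hK⟩ := eventually_atTop.1 (hup.bound.and hlow.bound)
  have hstep : ∀ k ≥ K, A (k + 1) ≤ A k + C * k ∧ A k + k / D ≤ A (k + 1) := by
    intro k hk
    obtain ⟨h1, h2⟩ := hK k hk
    simp only [Real.norm_eq_abs, abs_of_pos (hA.pos k), Nat.abs_cast] at h1 h2
    rw [mul_comm D, ← div_le_iff₀ hD] at h2
    rw [stepDiff] at h1 h2
    exact ⟨by linarith, by linarith⟩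
  have hupper : ∀ k ≥ K, A k ≤ A K + C / 2 * (k : ℝ) ^ 2 := by
    intro k hk
    induction k, hk using Nat.le_induction with
    | base => linarith [show 0 ≤ C / 2 * (K : ℝ) ^ 2 by positivity]
    | succ k hk ih =>
      push_cast
      nlinarith [(hstep k hk).1]
  -- The product `k (k - 1)` has forward difference exactly `2k`, so the induction loses nothing.
  have hlower : ∀ k ≥ K, ((k : ℝ) * (k - 1) - (K : ℝ) ^ 2) / (2 * D) ≤ A k := by
    intro k hk
    induction k, hk using Nat.le_induction with
    | base =>
      refine le_trans (div_nonpos_of_nonpos_of_nonneg ?_ (by positivity)) (hA.nonneg K)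
      nlinarith [Nat.cast_nonneg (α := ℝ) K]
    | succ k hk ih =>
      have h1 : (((k + 1 : ℕ) : ℝ) * ((k + 1 : ℕ) - 1) - (K : ℝ) ^ 2) / (2 * D) =
          ((k : ℝ) * (k - 1) - (K : ℝ) ^ 2) / (2 * D) + k / D := by
        push_cast
        field_simp
        ring
      linarith [(hstep k hk).2]
  refine ⟨1 / (8 * D), A K + C / 2, by positivity, by linarith [hA.nonneg K], ?_⟩
  filter_upwards [eventually_ge_atTop (2 * K + 2)] with k hk
  have hk' : 2 * (K : ℝ) + 2 ≤ k := by exact_mod_cast hk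
  have hK0 : (0 : ℝ) ≤ K := Nat.cast_nonneg K
  constructor
  · refine le_trans ?_ (hlower k (by omega))
    rw [le_div_iff₀ (by positivity)]
    have h1 : 1 / (8 * D) * (k : ℝ) ^ 2 * (2 * D) = (k : ℝ) ^ 2 / 4 := by field_simp; ring
    rw [h1]
    nlinarith
  · refine (hupper k (by omega)).trans ?_
    have : 1 ≤ (k : ℝ) ^ 2 := by nlinarith
    nlinarith [hA.nonneg K]

theorem isBigO_gpBound {m β φ a b : ℝ} (hm : 0 < m) (hβ : 0 < β) (hφ : 0 < φ) (ha : 0 < a)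
    (hb : 0 < b) {A : ℕ → ℝ} (hA : ∀ᶠ k : ℕ in atTop, a * (k : ℝ) ^ 2 ≤ A k ∧ A k ≤ b * (k : ℝ) ^ 2)
    (hlarge : ∀ᶠ k in atTop, m ^ 2 / (β * φ ^ 2) < A k) :
    (fun k : ℕ => gpBound m β φ (A k)) =O[atTop] fun k : ℕ => Real.log k ^ 2 / (k : ℝ) ^ 2 := by
  set κ := β * φ ^ 2 / m ^ 2 with hκ
  have hκ0 : 0 < κ := by positivity
  -- The `2` comes from `log k²`; the constant is absorbed because `log k ≥ 1` for `k ≥ 3`.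
  set D := |Real.log (κ * b)| + 2 with hD
  refine IsBigO.of_bound (2 * m ^ 2 / (φ ^ 2 * a) * (1 + D ^ 2)) ?_
  filter_upwards [hA, hlarge, eventually_ge_atTop 3] with k ⟨hak, hkb⟩ hlk hk
  have hk3 : (3 : ℝ) ≤ k := by exact_mod_cast hk
  have hk0 : (0 : ℝ) < k := by linarith
  have hAk : 0 < A k := lt_of_lt_of_le (by positivity) hak
  have hlog1 : 1 ≤ Real.log k := by
    rw [Real.le_log_iff_exp_le hk0]
    linarith [Real.exp_one_lt_d9]
  have harg : β * φ ^ 2 * A k / m ^ 2 = κ * A k := by rw [hκ]; ring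
  have hκA : 1 ≤ κ * A k := by
    rw [div_lt_iff₀ (by positivity)] at hlk
    rw [← harg, one_le_div (by positivity)]
    linarith
  have hlog0 : 0 ≤ Real.log (κ * A k) := Real.log_nonneg hκA
  have hlog : Real.log (κ * A k) ≤ D * Real.log k := by
    have h1 : Real.log (κ * A k) ≤ Real.log (κ * b * (k : ℝ) ^ 2) :=
      Real.log_le_log (by positivity) (by rw [mul_assoc]; exact mul_le_mul_of_nonneg_left hkb hκ0.le)
    rw [Real.log_mul (x := κ * b) (by positivity) (by positivity), Real.log_pow] at h1
    push_cast at h1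
    rw [hD]
    nlinarith [le_abs_self (Real.log (κ * b)), abs_nonneg (Real.log (κ * b))]
  have hsq : 1 + Real.log (κ * A k) ^ 2 ≤ (1 + D ^ 2) * Real.log k ^ 2 := by
    have h1 := pow_le_pow_left₀ hlog0 hlog 2
    have h2 := pow_le_pow_left₀ zero_le_one hlog1 2
    rw [mul_pow] at h1
    linarith
  have hpre : 2 * m ^ 2 / (φ ^ 2 * A k) ≤ 2 * m ^ 2 / (φ ^ 2 * (a * (k : ℝ) ^ 2)) :=
    div_le_div_of_nonneg_left (by positivity) (by positivity)
      (mul_le_mul_of_nonneg_left hak (by positivity))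
  rw [gpBound, harg, Real.norm_of_nonneg (by positivity), Real.norm_of_nonneg (by positivity)]
  refine (mul_le_mul hpre hsq (by positivity) (by positivity)).trans_eq ?_
  field_simp

end Rate

/-! ### Balancing the two estimates. -/

theorem mainTheorem10 {n N : ℕ} (c : Fin N → ℝ) (hc : ∀ l, 0 < c l)
    (ω : Fin N → Vec n) (hω : ∃ i j, ω i ≠ ω j)
    (f : Vec n → ℝ) (hf : f = gpObjective c ω)
    (pstar : Vec n) (hp : IsMinNormPoint pstar (closure (conjugateDomain f)))
    (g : Vec n → ℝ) (hg : g = tilt f pstar)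
    (m β φ : ℝ) (hm : m = affDim (Set.range ω)) (hβ : β = gpBeta c) (hφ : φ = facetGap ω) :
    IsSmoothConvex (gpSmoothness ω) f ∧
    BddBelow (Set.range g) ∧
    ∀ (L : ℝ) (A : ℕ → ℝ) (x : ℕ → Vec n),
      IsSmoothConvex L f → StepSizeCondition L A → IsAGMIterates f A 0 x →
        (∀ᶠ k in atTop, m ^ 2 / (β * φ ^ 2) < A k) ∧
        (∀ k, m ^ 2 / (β * φ ^ 2) < A k →
          ‖gradient f (x k) - pstar‖ ^ 2 / (2 * gpSmoothness ω) ≤ g (x k) - (⨅ u, g u) ∧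
          g (x k) - (⨅ u, g u) ≤ gpBound m β φ (A k)) ∧
        (fun k : ℕ => gpBound m β φ (A k)) =O[atTop]
          (fun k : ℕ => Real.log k ^ 2 / (k : ℝ) ^ 2) := by
  have : Nonempty (Fin N) := hω.nonempty
  subst hf hg
  rw [closure_conjugateDomain_gpObjective hc] at hp
  have hsmooth := isSmoothConvex_gpObjective hc hω
  have hbdd : BddBelow (Set.range (tilt (gpObjective c ω) pstar)) := by
    refine ⟨Real.log (⨅ l, c l), ?_⟩
    rintro _ ⟨x, rfl⟩
    have := inner_le_gpObjective hc hp.1 x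
    rw [tilt]
    linarith
  have hgrad : ∀ x, 0 ≤ inner ℝ (gradient (gpObjective c ω) x - pstar) pstar := fun x => by
    rw [gradient_gpObjective hc]
    exact inner_sub_minNormPoint_nonneg hp (gpMean_mem_newtonPolytope hc x)
  have hm0 : 0 < m := by
    obtain ⟨i, j, hij⟩ := hω
    rw [hm, Nat.cast_pos, affDim, Module.finrank_pos_iff_exists_ne_zero]
    exact ⟨⟨ω i - ω j, vsub_mem_vectorSpan ℝ (Set.mem_range_self i) (Set.mem_range_self j)⟩,
      fun h => sub_ne_zero.2 hij (congrArg Subtype.val h)⟩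
  have hφ0 : 0 < φ := hφ ▸ facetGap_pos hω
  have hβ0 : 0 < β := by
    obtain ⟨j, hj⟩ := exists_eq_ciInf_of_finite (f := c)
    rw [hβ, gpBeta, ← hj]
    exact div_pos (Finset.sum_pos (fun l _ => hc l) Finset.univ_nonempty) (hc j)
  refine ⟨hsmooth, hbdd, fun L A x hL hA hx => ?_⟩
  obtain ⟨a, b, ha, hb, hAab⟩ := hA.exists_quadratic_bounds
  have hlarge : ∀ᶠ k in atTop, m ^ 2 / (β * φ ^ 2) < A k := by
    have htends : Tendsto (fun k : ℕ => a * (k : ℝ) ^ 2) atTop atTop :=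
      ((tendsto_pow_atTop two_ne_zero).comp tendsto_natCast_atTop_atTop).const_mul_atTop ha
    filter_upwards [hAab, htends.eventually_gt_atTop (m ^ 2 / (β * φ ^ 2))] with k h1 h2
    exact h2.trans_le h1.1
  refine ⟨hlarge, fun k hk => ⟨hsmooth.norm_gradient_sq_le hbdd (x k), ?_⟩,
    isBigO_gpBound hm0 hβ0 hφ0 ha hb hAab hlarge⟩
  have hAk : 0 < A k := lt_of_le_of_lt (by positivity) hk
  -- With this `δ`, `2‖u‖²/A_k` is at most `2 δ log²(β/δ)`. The admissibility condition `δ ≤ β`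
  -- follows from the assumed lower bound on `A k`.
  set δ := m ^ 2 / (φ ^ 2 * A k) with hδ
  have hδ0 : 0 < δ := by positivity
  have hδβ : δ ≤ β := by
    rw [div_lt_iff₀ (by positivity)] at hk
    rw [hδ, div_le_iff₀ (by positivity)]
    linarith
  have hratio : β / δ = β * φ ^ 2 * A k / m ^ 2 := by
    rw [hδ]; field_simp
  -- The infimum need not be attained, so the comparison is made with an arbitrary `v`.
  suffices h : ∀ v, tilt (gpObjective c ω) pstar (x k) - gpBound m β φ (A k) ≤
      tilt (gpObjective c ω) pstar v by
    have := le_ciInf h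
    linarith
  intro v
  obtain ⟨u, hu, huv⟩ := exists_tilt_le hc hω hp.1 hδ0 (hβ ▸ hδβ) v
  rw [← hm, ← hβ, ← hφ, hratio] at hu
  have hagm := hx.tilt_sub_le hL hA hgrad u k
  rw [zero_sub, norm_neg] at hagm
  set ℓ := Real.log (β * φ ^ 2 * A k / m ^ 2) with hℓ
  have hsq : 2 * ‖u‖ ^ 2 ≤ A k * (2 * δ * ℓ ^ 2) := by
    have h1 := pow_le_pow_left₀ (norm_nonneg u) hu 2
    have h2 : A k * (2 * δ * ℓ ^ 2) = 2 * (m / φ * ℓ) ^ 2 := by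
      rw [hδ]; field_simp
    rw [h2]
    linarith
  have hgap := le_of_mul_le_mul_left (hagm.trans hsq) hAk
  have hbound : gpBound m β φ (A k) = 2 * δ * (1 + ℓ ^ 2) := by
    rw [gpBound, hδ, hℓ]; ring
  rw [hbound]
  linarith
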